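/- **Theorem (generalized Clifford wavelet uncertainty principle).** Let $n\equiv 2$ or $3 \pmod 4$ and let $Cl_n=Cl_{n,0}$ be the real Clifford algebra of Euclidean $\mathbb R^n$ with orthonormal basis $e_1,\dots,e_n$, so $x^2=|x|^2$ for $x\in\mathbb R^n$. Write $\langle M\rangle$ for the scalar part of $M\in Cl_n$, $\widetilde M$ for its reverse, $M\ast N=\langle MN\rangle$, $|M|^2=\langle M\widetilde M\rangle$, and $i_n=e_1e_2\cdots e_n$, so $i_n^2=-1$. For $F,G\in L^2(X;Cl_n)$ on a measure space $X$ put $(F,G)=\int_X F\,\widetilde G$ and $\|F\|^2=\int_X|F|^2$. The Clifford Fourier transform of $f\in L^2(\mathbb R^n;Cl_n)$ is $\hat f(\omega)=\int_{\mathbb R^n} f(x)\,e^{-i_n\,\omega\cdot x}\,d^nx$, the integral being the $L^2$-limit, as $R\to\infty$, of the integrals over the balls $|x|<R$. Let $\mathcal G=(\mathbb R^+\times SO(n))\ltimes\mathbb R^n$ be the similitude group with left Haar measure $d\lambda(a,r,b)=d\mu(a,r)\,d^nb$, $d\mu(a,r)=a^{-(n+1)}\,da\,dr$, where $dr$ is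 a Haar measure on $SO(n)$. Let $\psi\in L^2(\mathbb R^n;Cl_n)$ be an admissible wavelet, i.e. there is an invertible $C_\psi\in Cl_n$ such that for almost every $\omega\in\mathbb R^n$ the integral $$\int_{\mathbb R^+\times SO(n)} a^n\,\widetilde{\hat\psi(a r^{-1}\omega)}\;\hat\psi(a r^{-1}\omega)\,d\mu(a,r)$$ converges absolutely and equals $C_\psi$; if $n\equiv2\pmod4$, assume moreover that $\psi$ takes its values either in the even part or in the odd part of $Cl_n$. For $f\in L^2(\mathbb R^n;Cl_n)$ put $$T_\psi f(a,r,b)=\int_{\mathbb R^n} f(x)\,\widetilde{\psi_{a,r,b}(x)}\,d^nx,\qquad \psi_{a,r,b}(x)=a^{-n/2}\,\psi\bigl(r^{-1}(\tfrac{x-b}{a})\bigr).$$ Then for every $f\in L^2(\mathbb R^n;Cl_n)$ $$\bigl\|\,b\,T_\psi f(a,r,b)\bigr\|^2_{L^2(\mathcal G;Cl_n)}\;\cdot\; C_\psi\ast\bigl(\widetilde{\omega\hat f},\widetilde{\omega\hat f}\bigr)_{L^2(\mathbb R^n;Cl_n)}\;\ge\;\frac{n(2\pi)^n}{4}\,\Bigl[C_\psi\ast(\tilde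 f,\tilde f)_{L^2(\mathbb R^n;Cl_n)}\Bigr]^2 .$$ Both factors on the left are read in $[0,\infty]$, the second being $\infty$ if $\omega\hat f\notin L^2(\mathbb R^n;Cl_n)$, with $0\cdot\infty=0$. -/

import Mathlib

open MeasureTheory Filter Topology
open scoped ENNReal

noncomputable section

namespace CliffordWavelet

/-- Euclidean space `ℝⁿ`. -/
abbrev E (n : ℕ) : Type := EuclideanSpace ℝ (Fin n)

/-- The positive definite quadratic form `x ↦ ⟪x, x⟫` on `ℝⁿ`. -/
def Q (n : ℕ) : QuadraticForm ℝ (E n) := LinearMap.BilinMap.toQuadraticMap (innerₗ (E n))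

/-- The real Clifford geometric algebra `Clₙ = Cl_{n,0}`. -/
abbrev Cl (n : ℕ) : Type := CliffordAlgebra (Q n)

variable {n : ℕ}

/-- A vector of `ℝⁿ`, viewed as a multivector of grade one. -/
def vec (x : E n) : Cl n := CliffordAlgebra.ι (Q n) x

/-- The reverse `M ↦ M~`, the anti-automorphism of `Clₙ` fixing vectors. -/
def rev (M : Cl n) : Cl n := CliffordAlgebra.reverse M

/-- The scalar part `⟨M⟩₀`: the component of degree zero under the canonical linear isomorphism
of `Clₙ` with the exterior algebra of `ℝⁿ`. -/
def Sc (M : Cl n) : ℝ :=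
  letI : Invertible (2 : ℝ) := invertibleOfNonzero two_ne_zero
  ExteriorAlgebra.algebraMapInv (CliffordAlgebra.equivExterior (Q n) M)

/-- The scalar product `M ∗ N = ⟨M N⟩₀`. -/
def scalarProd (M N : Cl n) : ℝ := Sc (M * N)

/-- The squared modulus `|M|² = M ∗ M~`. -/
def modSq (M : Cl n) : ℝ := scalarProd M (rev M)

/-- The basis blade `e_A = e_{i₁} ⋯ e_{iₖ}` for `A = {i₁ < ⋯ < iₖ}`. -/
def blade (A : Finset (Fin n)) : Cl n :=
  ((A.sort (· ≤ ·)).map fun i => vec (EuclideanSpace.single i (1 : ℝ))).prod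

/-- The coefficient `M_A` in `M = ∑_A M_A e_A`; the blades are orthonormal for `M ∗ N~`. -/
def coord (A : Finset (Fin n)) (M : Cl n) : ℝ := scalarProd M (rev (blade A))

/-- The unit pseudoscalar `iₙ = e₁ e₂ ⋯ eₙ`. -/
def pseudo (n : ℕ) : Cl n := blade Finset.univ

/-- The exponential `e^{iₙ t} = cos t + iₙ sin t` (used where `iₙ² = -1`). -/
def expI (t : ℝ) : Cl n := Real.cos t • (1 : Cl n) + Real.sin t • pseudo n

section Integration

variable {X : Type*} [MeasurableSpace X]

/-- Integrability of a multivector valued function: all its blade components are integrable. -/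
def ClIntegrable (F : X → Cl n) (μ : Measure X) : Prop :=
  ∀ A : Finset (Fin n), Integrable (fun x => coord A (F x)) μ

/-- The integral `∑_A (∫ F_A dμ) e_A` of a multivector valued function. -/
def clIntegral (μ : Measure X) (F : X → Cl n) : Cl n :=
  ∑ A : Finset (Fin n), (∫ x, coord A (F x) ∂μ) • blade A

/-- `F ∈ L²(X; Clₙ)`: all blade components are square integrable. -/
def IsL2 (F : X → Cl n) (μ : Measure X) : Prop :=
  ∀ A : Finset (Fin n), MemLp (fun x => coord A (F x)) 2 μ

/-- The multivector valued inner product `(F, G) = ∫ F G~ dμ`. -/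
def innerCl (μ : Measure X) (F G : X → Cl n) : Cl n :=
  clIntegral μ fun x => F x * rev (G x)

/-- The squared norm `‖F‖² = ∫ |F|² dμ`, with values in `[0, ∞]`. -/
def normSqL2 (μ : Measure X) (F : X → Cl n) : ℝ≥0∞ :=
  ∫⁻ x, ENNReal.ofReal (modSq (F x)) ∂μ

open Classical in
/-- The quantity `C ∗ (G, G)` with values in `[0, ∞]`: it is `∞` if `G` is not in `L²`. -/
def starSelf (μ : Measure X) (C : Cl n) (G : X → Cl n) : ℝ≥0∞ :=
  if IsL2 G μ then ENNReal.ofReal (scalarProd C (innerCl μ G G)) else ⊤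

end Integration

/-- The Clifford Fourier integral `∫ f(x) e^{-iₙ ω·x} dx`. -/
def cftIntegral (f : E n → Cl n) (ω : E n) : Cl n :=
  clIntegral volume fun x => f x * expI (-(inner ℝ ω x))

/-- `F` is a Clifford Fourier transform of `f ∈ L²(ℝⁿ; Clₙ)`: the limit in `L²`, as `R → ∞`, of
the Fourier integrals of `f` over the balls of radius `R`. -/
def IsCFT (f F : E n → Cl n) : Prop :=
  IsL2 F volume ∧
    Tendsto (fun R : ℝ => normSqL2 volume fun ω =>
      F ω - cftIntegral ((Metric.ball (0 : E n) R).indicator f) ω) atTop (𝓝 0)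

/-- The Clifford Fourier transform of `f ∈ L²(ℝⁿ; Clₙ)` (determined almost everywhere). -/
def cft (f : E n → Cl n) : E n → Cl n := Classical.epsilon (IsCFT f)

/-- The rotation group `SO(n)`. -/
abbrev SO (n : ℕ) : Type := Matrix.specialOrthogonalGroup (Fin n) ℝ

instance : MeasurableSpace (SO n) := borel _

instance : BorelSpace (SO n) := ⟨rfl⟩

/-- The action of a rotation on `ℝⁿ`. -/
def rot (r : SO n) (x : E n) : E n := WithLp.toLp 2 (Matrix.mulVec r.1 x.ofLp)

/-- The measure `dμ(a, θ) = a^{-(n+1)} da dθ` on `ℝ⁺ × SO(n)`, where `dθ = ν`. The first factor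
is carried by the positive reals. -/
def dilRotMeasure (ν : Measure (SO n)) : Measure (ℝ × SO n) :=
  ((volume.restrict (Set.Ioi (0 : ℝ))).withDensity
    fun a => ENNReal.ofReal ((a ^ (n + 1))⁻¹)).prod ν

/-- The left Haar measure `dλ(a, θ, b) = dμ(a, θ) db` on the similitude group
`SIM(n) = (ℝ⁺ × SO(n)) ⋉ ℝⁿ`. -/
def simMeasure (ν : Measure (SO n)) : Measure ((ℝ × SO n) × E n) :=
  (dilRotMeasure ν).prod volume

/-- The daughter wavelet `ψ_{a,θ,b}(x) = a^{-n/2} ψ(r_θ⁻¹((x - b)/a))`. -/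
def daughter (ψ : E n → Cl n) (g : (ℝ × SO n) × E n) (x : E n) : Cl n :=
  (g.1.1 ^ ((n : ℝ) / 2))⁻¹ • ψ (rot g.1.2⁻¹ (g.1.1⁻¹ • (x - g.2)))

/-- The Clifford wavelet transform `T_ψ f(a,θ,b) = ∫ f(x) ψ_{a,θ,b}(x)~ dx`. -/
def waveletTransform (ψ f : E n → Cl n) (g : (ℝ × SO n) × E n) : Cl n :=
  innerCl volume f (daughter ψ g)

/-- The integrand `aⁿ ψ̂(a r_θ⁻¹ ω)~ ψ̂(a r_θ⁻¹ ω)` of the admissibility constant. -/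
def admIntegrand (ψ : E n → Cl n) (ω : E n) (p : ℝ × SO n) : Cl n :=
  p.1 ^ n • (rev (cft ψ (p.1 • rot p.2⁻¹ ω)) * cft ψ (p.1 • rot p.2⁻¹ ω))

/-- `ψ ∈ L²(ℝⁿ; Clₙ)` is admissible with admissibility constant `C = C_ψ`: for almost every `ω`
the integral `∫ aⁿ ψ̂(a r_θ⁻¹ ω)~ ψ̂(a r_θ⁻¹ ω) dμ(a,θ)` is finite and equal to the
invertible multivector `C`. -/
def IsAdmissible (ν : Measure (SO n)) (ψ : E n → Cl n) (C : Cl n) : Prop :=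
  IsL2 ψ volume ∧ IsUnit C ∧
    ∀ᵐ ω : E n, ClIntegrable (admIntegrand ψ ω) (dilRotMeasure ν) ∧
      clIntegral (dilRotMeasure ν) (admIntegrand ψ ω) = C

/-- `ψ` takes values (almost everywhere) in the even part or in the odd part of `Clₙ`. -/
def HasParity (ψ : E n → Cl n) : Prop :=
  (∀ᵐ x : E n, ψ x ∈ CliffordAlgebra.evenOdd (Q n) 0) ∨
    (∀ᵐ x : E n, ψ x ∈ CliffordAlgebra.evenOdd (Q n) 1)

end CliffordWavelet

end

/-!
Let `F = f̂`, `Ψ = ψ̂` and `H(a, r; ω) = F(ω) (a^{n/2} Ψ(a r⁻¹ ω))~`. The parity of `ψ` (or `n` odd)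
makes `Ψ` commute or anticommute with `iₙ`, so the exponential of the Plancherel formula for
`T_ψ f(a, r, b)` can be pulled to the right of `H`: up to the factor `(2π)ⁿ` and the sign of `b`,
the Fourier transform of `H(a, r; ·)` is `b ↦ T_ψ f(a, r, b)`. Integrating
`|H(a, r; ω)|² = ⟨F(ω), F(ω) aⁿ Ψ(a r⁻¹ ω)~ Ψ(a r⁻¹ ω)⟩` over `(a, r)` gives
`⟨F(ω), F(ω) C⟩` by admissibility, and `C` commutes with `iₙ`, so Parseval's formula turns the
integral over `ω` into `(2π)ⁿ C ∗ (f~, f~)`.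

The claim is thereby Heisenberg's inequality for a family `H(p; ·)` of functions on `ℝⁿ`. For each
coordinate `k`, Plancherel bounds the `L²` distance of `H` from its translate by `t eₖ` by
`|t|` times the norm of `bₖ Ĥ`; expanding `∫ ωₖ |H|²` under this translation to first order in `t`
gives the one-coordinate inequality, and the Cauchy–Schwarz inequality over the `n` coordinates
yields the constant `n²`.
-/

noncomputable section

namespace CliffordWavelet

variable {n : ℕ}

/-! ### Blades -/

/-- The generator `eᵢ` of the Clifford algebra. -/
def gen (i : Fin n) : Cl n := vec (EuclideanSpace.single i (1 : ℝ))

/-- The product `e_{i₁} ⋯ e_{iₖ}` over a list of indices. Unlike for `blade`, the indices need be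
neither sorted nor distinct, which makes induction possible. -/
def genProd (l : List (Fin n)) : Cl n := (l.map gen).prod

@[simp] lemma genProd_nil : genProd ([] : List (Fin n)) = 1 := rfl

@[simp] lemma genProd_cons (i : Fin n) (l : List (Fin n)) :
    genProd (i :: l) = gen i * genProd l := by simp [genProd]

lemma genProd_append (l l' : List (Fin n)) : genProd (l ++ l') = genProd l * genProd l' := by
  simp [genProd]

lemma blade_eq_genProd (A : Finset (Fin n)) : blade A = genProd (A.sort (· ≤ ·)) := rfl

@[simp] lemma blade_empty : blade (∅ : Finset (Fin n)) = 1 := by simp [blade]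

lemma vec_eq_sum (x : E n) : vec x = ∑ i, x i • gen i := by
  conv_lhs => rw [← (EuclideanSpace.basisFun (Fin n) ℝ).sum_repr x]
  simp [gen, vec]

lemma vec_mul_self (x : E n) : vec x * vec x = (‖x‖ ^ 2) • (1 : Cl n) := by
  rw [vec, CliffordAlgebra.ι_sq_scalar, Algebra.algebraMap_eq_smul_one,
    ← real_inner_self_eq_norm_sq]
  rfl

lemma gen_mul_self (i : Fin n) : gen i * gen i = (1 : Cl n) := by
  simp [gen, vec_mul_self]

lemma vec_mul_vec_of_inner_eq_zero {x y : E n} (h : inner ℝ x y = 0) :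
    vec x * vec y = -(vec y * vec x) := by
  refine CliffordAlgebra.ι_mul_ι_comm_of_isOrtho ?_
  simp [QuadraticMap.isOrtho_def, Q, inner_add_right, real_inner_comm x y, h]

lemma gen_mul_gen {i j : Fin n} (h : i ≠ j) : gen i * gen j = -(gen j * gen i : Cl n) := by
  refine vec_mul_vec_of_inner_eq_zero ?_
  rw [EuclideanSpace.inner_single_left]
  simp [h]

lemma genProd_perm {l l' : List (Fin n)} (h : l.Perm l') (hl : l.Nodup) :
    genProd l = genProd l' ∨ genProd l = -genProd l' := by
  induction h with
  | nil => simp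
  | cons x _ ih =>
    rcases ih (List.nodup_cons.1 hl).2 with h | h <;> simp [h]
  | swap x y l =>
    have hxy : y ≠ x := fun h => by simp [h] at hl
    right
    simp only [genProd_cons, ← mul_assoc, gen_mul_gen hxy, neg_mul]
  | trans h₁ _ ih₁ ih₂ =>
    rcases ih₁ hl with h | h <;> rcases ih₂ (h₁.nodup_iff.1 hl) with h' | h' <;> simp [h, h']

lemma genProd_eq_blade {l : List (Fin n)} (h : l.Nodup) :
    genProd l = blade l.toFinset ∨ genProd l = -blade l.toFinset :=
  genProd_perm ((List.perm_ext_iff_of_nodup h (Finset.sort_nodup _ _)).2 fun a => by simp) h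

lemma genProd_mul_gen {i : Fin n} {l : List (Fin n)} (h : i ∉ l) :
    genProd l * gen i = (-1 : ℝ) ^ l.length • (gen i * genProd l) := by
  induction l with
  | nil => simp
  | cons x l ih =>
    simp only [List.mem_cons, not_or] at h
    rw [genProd_cons, mul_assoc, ih h.2, mul_smul_comm, ← mul_assoc, gen_mul_gen (Ne.symm h.1),
      List.length_cons, pow_succ, mul_smul]
    simp [mul_assoc]

lemma gen_mul_blade_of_notMem {i : Fin n} {A : Finset (Fin n)} (h : i ∉ A) :
    gen i * blade A = blade (insert i A) ∨ gen i * blade A = -blade (insert i A) := by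
  have := genProd_eq_blade (l := i :: A.sort (· ≤ ·)) (by simp [h, Finset.sort_nodup])
  simpa [← blade_eq_genProd] using this

lemma gen_mul_blade (i : Fin n) (A : Finset (Fin n)) :
    gen i * blade A = blade (symmDiff {i} A) ∨ gen i * blade A = -blade (symmDiff {i} A) := by
  by_cases h : i ∈ A
  · have hs : insert i (symmDiff {i} A) = A := by grind [Finset.mem_symmDiff]
    have hi : i ∉ symmDiff {i} A := by simp [Finset.mem_symmDiff, h]
    have key : gen i * (gen i * blade (symmDiff {i} A)) = blade (symmDiff {i} A) := by
      rw [← mul_assoc, gen_mul_self, one_mul]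
    rcases gen_mul_blade_of_notMem hi with h' | h' <;> rw [hs] at h' <;> rw [h'] at key
    · exact .inl key
    · exact .inr (neg_eq_iff_eq_neg.1 (mul_neg (gen i) (blade A) ▸ key))
  · rw [show symmDiff {i} A = insert i A by grind [Finset.mem_symmDiff]]
    exact gen_mul_blade_of_notMem h

lemma genProd_mul_blade {l : List (Fin n)} (hl : l.Nodup) (B : Finset (Fin n)) :
    genProd l * blade B = blade (symmDiff l.toFinset B) ∨
      genProd l * blade B = -blade (symmDiff l.toFinset B) := by
  induction l with
  | nil => simp [← Finset.bot_eq_empty]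
  | cons x l ih =>
    rw [List.nodup_cons] at hl
    have hs : symmDiff (x :: l).toFinset B = symmDiff {x} (symmDiff l.toFinset B) := by
      ext j
      grind [Finset.mem_symmDiff, List.mem_toFinset]
    rw [hs, genProd_cons, mul_assoc]
    rcases ih hl.2 with h | h <;> rcases gen_mul_blade x (symmDiff l.toFinset B) with h' | h' <;>
      simp [h, h']

lemma blade_mul_blade (A B : Finset (Fin n)) :
    blade A * blade B = blade (symmDiff A B) ∨ blade A * blade B = -blade (symmDiff A B) := by
  simpa [← blade_eq_genProd] using genProd_mul_blade (Finset.sort_nodup A (· ≤ ·)) B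

lemma span_blade : Submodule.span ℝ (Set.range (blade : Finset (Fin n) → Cl n)) = ⊤ := by
  have gen_mul_mem (i : Fin n) {M : Cl n} (hM : M ∈ Submodule.span ℝ (Set.range blade)) :
      gen i * M ∈ Submodule.span ℝ (Set.range (blade : Finset (Fin n) → Cl n)) := by
    have hle : Submodule.span ℝ (Set.range blade) ≤
        (Submodule.span ℝ (Set.range blade)).comap (LinearMap.mulLeft ℝ (gen i)) := by
      refine Submodule.span_le.2 ?_
      rintro _ ⟨A, rfl⟩
      change gen i * blade A ∈ Submodule.span ℝ (Set.range blade)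
      have hA : blade (symmDiff {i} A) ∈ Submodule.span ℝ (Set.range (blade (n := n))) :=
        Submodule.subset_span (Set.mem_range_self _)
      rcases gen_mul_blade i A with h | h <;> rw [h]
      exacts [hA, Submodule.neg_mem _ hA]
    exact hle hM
  refine eq_top_iff.2 fun M _ => ?_
  induction M using CliffordAlgebra.left_induction with
  | algebraMap r =>
    rw [Algebra.algebraMap_eq_smul_one, ← blade_empty]
    exact Submodule.smul_mem _ _ (Submodule.subset_span ⟨_, rfl⟩)
  | add M N hM hN => exact Submodule.add_mem _ (hM trivial) (hN trivial)
  | ι_mul M x hM =>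
    change vec x * M ∈ _
    rw [vec_eq_sum, Finset.sum_mul]
    refine Submodule.sum_mem _ fun i _ => ?_
    rw [smul_mul_assoc]
    exact Submodule.smul_mem _ _ (gen_mul_mem i (hM trivial))

lemma linearMap_ext_blade {V : Type*} [AddCommGroup V] [Module ℝ V] {S T : Cl n →ₗ[ℝ] V}
    (h : ∀ A, S (blade A) = T (blade A)) : S = T :=
  LinearMap.ext_on_range span_blade h

/-! ### Reversion -/

lemma rev_mul (M N : Cl n) : rev (M * N) = rev N * rev M := CliffordAlgebra.reverse.map_mul M N

@[simp] lemma rev_rev (M : Cl n) : rev (rev M) = M := CliffordAlgebra.reverse_reverse M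

@[simp] lemma rev_vec (x : E n) : rev (vec x) = vec x := CliffordAlgebra.reverse_ι x

@[simp] lemma rev_one : rev (1 : Cl n) = 1 := CliffordAlgebra.reverse.map_one

@[simp] lemma rev_add (M N : Cl n) : rev (M + N) = rev M + rev N := map_add _ _ _

@[simp] lemma rev_neg (M : Cl n) : rev (-M) = -rev M := map_neg _ _

@[simp] lemma rev_smul (c : ℝ) (M : Cl n) : rev (c • M) = c • rev M := map_smul _ _ _

lemma rev_genProd (l : List (Fin n)) : rev (genProd l) = genProd l.reverse := by
  induction l with
  | nil => simp
  | cons x l ih => simp [rev_mul, ih, genProd_append, gen]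

lemma rev_genProd_of_nodup {l : List (Fin n)} (h : l.Nodup) :
    rev (genProd l) = (-1 : ℝ) ^ (l.length * (l.length - 1) / 2) • genProd l := by
  induction l with
  | nil => simp
  | cons x l ih =>
    rw [List.nodup_cons] at h
    rw [genProd_cons, rev_mul, ih h.2, gen, rev_vec, ← gen, smul_mul_assoc, genProd_mul_gen h.1,
      smul_smul, ← pow_add]
    simp only [List.length_cons, ← Nat.triangle_succ, Nat.add_sub_cancel]

lemma rev_blade (A : Finset (Fin n)) : rev (blade A) = blade A ∨ rev (blade A) = -blade A := by
  rw [blade_eq_genProd, rev_genProd]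
  exact genProd_perm (List.reverse_perm _) (List.nodup_reverse.2 (Finset.sort_nodup _ _))

lemma genProd_mul_rev (l : List (Fin n)) : genProd l * rev (genProd l) = 1 := by
  induction l with
  | nil => simp
  | cons x l ih =>
    rw [genProd_cons, rev_mul, ← mul_assoc, mul_assoc (gen x), ih, mul_one, gen, rev_vec]
    exact gen_mul_self x

lemma blade_mul_rev (A : Finset (Fin n)) : blade A * rev (blade A) = 1 := genProd_mul_rev _

/-! ### Scalar part -/

/-- `Sc` as a linear form. -/
def scₗ : Cl n →ₗ[ℝ] ℝ :=
  letI : Invertible (2 : ℝ) := invertibleOfNonzero two_ne_zero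
  ExteriorAlgebra.algebraMapInv.toLinearMap ∘ₗ (CliffordAlgebra.equivExterior (Q n)).toLinearMap

@[simp] lemma Sc_add (M N : Cl n) : Sc (M + N) = Sc M + Sc N := map_add scₗ M N

@[simp] lemma Sc_neg (M : Cl n) : Sc (-M) = -Sc M := map_neg scₗ M

@[simp] lemma Sc_zero : Sc (0 : Cl n) = 0 := map_zero scₗ

@[simp] lemma Sc_smul (c : ℝ) (M : Cl n) : Sc (c • M) = c * Sc M := map_smul scₗ c M

@[simp] lemma Sc_one : Sc (1 : Cl n) = 1 := by
  let _ : Invertible (2 : ℝ) := invertibleOfNonzero two_ne_zero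
  change ExteriorAlgebra.algebraMapInv (CliffordAlgebra.changeForm
    CliffordAlgebra.changeForm.associated_neg_proof (1 : Cl n)) = 1
  rw [CliffordAlgebra.changeForm_one]
  exact map_one ExteriorAlgebra.algebraMapInv

lemma associated_neg_Q : QuadraticMap.associated (R := ℝ) (-(Q n)) = -innerₗ (E n) := by
  rw [map_neg, Q, QuadraticMap.associated_left_inverse]
  exact fun x y => real_inner_comm y x

lemma Sc_vec_mul (x : E n) (M : Cl n) :
    Sc (vec x * M) = Sc (CliffordAlgebra.contractLeft (innerₗ (E n) x) M) := by
  let _ : Invertible (2 : ℝ) := invertibleOfNonzero two_ne_zero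
  change ExteriorAlgebra.algebraMapInv (CliffordAlgebra.changeForm
    CliffordAlgebra.changeForm.associated_neg_proof (CliffordAlgebra.ι (Q n) x * M)) =
    ExteriorAlgebra.algebraMapInv (CliffordAlgebra.changeForm
      CliffordAlgebra.changeForm.associated_neg_proof
      (CliffordAlgebra.contractLeft (innerₗ (E n) x) M))
  have hι : ExteriorAlgebra.algebraMapInv
      (CliffordAlgebra.ι (0 : QuadraticForm ℝ (E n)) x : ExteriorAlgebra ℝ (E n)) = 0 := by
    change ExteriorAlgebra.algebraMapInv (ExteriorAlgebra.ι ℝ x) = 0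
    simp [ExteriorAlgebra.algebraMapInv]
  rw [CliffordAlgebra.changeForm_ι_mul, CliffordAlgebra.changeForm_contractLeft, map_sub]
  generalize CliffordAlgebra.changeForm _ M = N
  rw [associated_neg_Q, LinearMap.neg_apply, map_neg, LinearMap.neg_apply, map_neg,
    sub_neg_eq_add, map_mul, hι, zero_mul, zero_add]

lemma contractLeft_genProd {i : Fin n} {l : List (Fin n)} (h : i ∉ l) :
    CliffordAlgebra.contractLeft (innerₗ (E n) (EuclideanSpace.single i (1 : ℝ))) (genProd l) =
      0 := by
  induction l with
  | nil => simp
  | cons x l ih =>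
    simp only [List.mem_cons, not_or] at h
    rw [genProd_cons, gen, vec, CliffordAlgebra.contractLeft_ι_mul, ih h.2, innerₗ_apply_apply,
      EuclideanSpace.inner_single_left]
    simp [h.1]

lemma Sc_blade {A : Finset (Fin n)} (h : A.Nonempty) : Sc (blade A) = 0 := by
  have hA := Finset.sort_nodup A (· ≤ ·)
  rw [blade_eq_genProd]
  cases hl : A.sort (· ≤ ·) with
  | nil =>
    have : A.card = 0 := by rw [← Finset.length_sort (· ≤ ·), hl, List.length_nil]
    exact absurd this h.card_ne_zero
  | cons x l =>
    rw [hl, List.nodup_cons] at hA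
    rw [genProd_cons, gen, Sc_vec_mul, contractLeft_genProd hA.1, Sc_zero]

lemma Sc_blade_mul_blade {A B : Finset (Fin n)} (h : A ≠ B) : Sc (blade A * blade B) = 0 := by
  have hAB : (symmDiff A B).Nonempty := Finset.nonempty_iff_ne_empty.2 (mt symmDiff_eq_bot.1 h)
  rcases blade_mul_blade A B with h | h <;> simp [h, Sc_blade hAB]

lemma Sc_mul_comm (M N : Cl n) : Sc (M * N) = Sc (N * M) := by
  have : (LinearMap.mul ℝ (Cl n)).compr₂ scₗ = (LinearMap.mul ℝ (Cl n)).flip.compr₂ scₗ := by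
    refine linearMap_ext_blade fun A => linearMap_ext_blade fun B => ?_
    change Sc (blade A * blade B) = Sc (blade B * blade A)
    by_cases h : A = B
    · rw [h]
    · rw [Sc_blade_mul_blade h, Sc_blade_mul_blade (Ne.symm h)]
  exact congrArg (fun T => T M N) this

lemma Sc_rev (M : Cl n) : Sc (rev M) = Sc M := by
  have : scₗ ∘ₗ CliffordAlgebra.reverse = (scₗ : Cl n →ₗ[ℝ] ℝ) := by
    refine linearMap_ext_blade fun A => ?_
    change Sc (rev (blade A)) = Sc (blade A)
    obtain rfl | hA := A.eq_empty_or_nonempty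
    · rw [blade_empty, rev_one]
    · rcases rev_blade A with h | h <;> simp [h, Sc_blade hA]
  exact congrArg (fun T => T M) this

/-! ### Pseudoscalar -/

lemma odd_mul_pred_div_two (hn : n % 4 = 2 ∨ n % 4 = 3) : Odd (n * (n - 1) / 2) := by
  obtain ⟨k, rfl | rfl⟩ : ∃ k, n = 4 * k + 2 ∨ n = 4 * k + 3 := ⟨n / 4, by omega⟩
  · refine ⟨4 * k * k + 3 * k, Nat.div_eq_of_eq_mul_right two_pos ?_⟩
    rw [show 4 * k + 2 - 1 = 4 * k + 1 by omega]
    ring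
  · refine ⟨4 * k * k + 5 * k + 1, Nat.div_eq_of_eq_mul_right two_pos ?_⟩
    rw [show 4 * k + 3 - 1 = 4 * k + 2 by omega]
    ring

lemma rev_pseudo (hn : n % 4 = 2 ∨ n % 4 = 3) : rev (pseudo n) = -pseudo n := by
  have h := rev_genProd_of_nodup (Finset.sort_nodup (Finset.univ : Finset (Fin n)) (· ≤ ·))
  rwa [← blade_eq_genProd, Finset.length_sort, Finset.card_univ, Fintype.card_fin,
    (odd_mul_pred_div_two hn).neg_one_pow, neg_one_smul] at h

lemma pseudo_mul_self (hn : n % 4 = 2 ∨ n % 4 = 3) : pseudo n * pseudo n = -1 := by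
  have h : pseudo n * rev (pseudo n) = 1 := blade_mul_rev Finset.univ
  rwa [rev_pseudo hn, mul_neg, neg_eq_iff_eq_neg] at h

lemma gen_mul_pseudo (i : Fin n) : gen i * pseudo n = (-1 : ℝ) ^ (n - 1) • (pseudo n * gen i) := by
  set l := (Finset.univ.erase i : Finset (Fin n)).sort (· ≤ ·) with hl
  have hswap : genProd l * gen i = (-1 : ℝ) ^ (n - 1) • (gen i * genProd l) := by
    simpa [hl] using genProd_mul_gen (i := i) (l := l) (by simp [hl])
  have key : gen i * (gen i * genProd l) = (-1 : ℝ) ^ (n - 1) • ((gen i * genProd l) * gen i) := by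
    rw [mul_assoc (gen i) (genProd l), hswap, mul_smul_comm, smul_smul, ← mul_pow]
    simp
  have hpseudo := gen_mul_blade_of_notMem (Finset.notMem_erase i (Finset.univ : Finset (Fin n)))
  rw [Finset.insert_erase (Finset.mem_univ i), blade_eq_genProd] at hpseudo
  rcases hpseudo with h | h
  · rw [pseudo, ← h]
    exact key
  · rw [pseudo, ← neg_eq_iff_eq_neg.2 h, mul_neg, key, neg_mul, smul_neg]

lemma vec_mul_pseudo (x : E n) : vec x * pseudo n = (-1 : ℝ) ^ (n - 1) • (pseudo n * vec x) := by
  simp only [vec_eq_sum, Finset.sum_mul, Finset.mul_sum, Finset.smul_sum, smul_mul_assoc,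
    mul_smul_comm, gen_mul_pseudo]
  exact Finset.sum_congr rfl fun i _ => smul_comm _ _ _

lemma mul_pseudo_of_odd (hn : Odd n) (M : Cl n) : M * pseudo n = pseudo n * M := by
  have hn' : Even (n - 1) := by grind
  induction M using CliffordAlgebra.left_induction with
  | algebraMap r => exact Algebra.commutes r _
  | add M N hM hN => rw [add_mul, mul_add, hM, hN]
  | ι_mul M x hM =>
    have hx := vec_mul_pseudo x
    rw [hn'.neg_one_pow, one_smul, vec] at hx
    rw [mul_assoc, hM, ← mul_assoc, ← mul_assoc, hx]

lemma mul_pseudo_of_even (hn₀ : n ≠ 0) (hn : Even n) (M : Cl n) :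
    M * pseudo n = pseudo n * CliffordAlgebra.involute M := by
  have hn' : Odd (n - 1) := by grind
  induction M using CliffordAlgebra.left_induction with
  | algebraMap r => rw [AlgHom.commutes]; exact Algebra.commutes r _
  | add M N hM hN => rw [add_mul, map_add, mul_add, hM, hN]
  | ι_mul M x hM =>
    have hx := vec_mul_pseudo x
    rw [hn'.neg_one_pow, neg_one_smul, vec] at hx
    rw [mul_assoc, hM, map_mul, CliffordAlgebra.involute_ι, ← mul_assoc, ← mul_assoc, hx,
      mul_neg, neg_mul]

lemma involute_pseudo (hn : Even n) : CliffordAlgebra.involute (pseudo n) = pseudo n := by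
  have h : pseudo n = (((Finset.univ : Finset (Fin n)).sort (· ≤ ·)).map
      (fun i => EuclideanSpace.single i (1 : ℝ)) |>.map (CliffordAlgebra.ι (Q n))).prod := by
    rw [List.map_map]; rfl
  rw [h, CliffordAlgebra.involute_prod_map_ι, List.length_map, Finset.length_sort,
    Finset.card_univ, Fintype.card_fin, hn.neg_one_pow, one_smul]

/-! ### Inner product -/

lemma Sc_blade_mul_rev_blade (A B : Finset (Fin n)) :
    Sc (blade A * rev (blade B)) = if A = B then 1 else 0 := by
  split_ifs with h
  · rw [h, blade_mul_rev, Sc_one]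
  · rcases rev_blade B with h' | h' <;> simp [h', Sc_blade_mul_blade h]

/-- `coord A` as a linear form. -/
def coordₗ (A : Finset (Fin n)) : Cl n →ₗ[ℝ] ℝ :=
  scₗ ∘ₗ LinearMap.mulRight ℝ (rev (blade A))

lemma coordₗ_apply (A : Finset (Fin n)) (M : Cl n) : coordₗ A M = coord A M := rfl

lemma coord_blade (A B : Finset (Fin n)) : coord A (blade B) = if B = A then 1 else 0 :=
  Sc_blade_mul_rev_blade B A

lemma sum_coord_smul_blade (M : Cl n) : ∑ A, coord A M • blade A = M := by
  have : ∑ A, (coordₗ A).smulRight (blade A) = (LinearMap.id : Cl n →ₗ[ℝ] Cl n) :=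
    linearMap_ext_blade fun B => by simp [coordₗ_apply, coord_blade]
  simpa [coordₗ_apply] using congrArg (fun T => T M) this

instance : FiniteDimensional ℝ (Cl n) :=
  ⟨span_blade (n := n) ▸ Submodule.fg_span (Set.finite_range blade)⟩

lemma Sc_mul_rev (M N : Cl n) : Sc (M * rev N) = ∑ A, coord A M * coord A N := by
  let T : Cl n →ₗ[ℝ] ℝ := scₗ ∘ₗ LinearMap.mulLeft ℝ M ∘ₗ CliffordAlgebra.reverse
  calc Sc (M * rev N) = T (∑ A, coord A N • blade A) := by rw [sum_coord_smul_blade]; rfl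
    _ = ∑ A, coord A N * T (blade A) := by simp only [map_sum, map_smul, smul_eq_mul]
    _ = ∑ A, coord A M * coord A N := Finset.sum_congr rfl fun A _ => mul_comm _ _

/-- The scalar product `M ∗ N~`, which makes `Clₙ` a Euclidean space in which the blades are
orthonormal. -/
@[reducible] def innerCore : InnerProductSpace.Core ℝ (Cl n) where
  inner M N := Sc (M * rev N)
  conj_inner_symm M N := by
    change Sc (N * rev M) = Sc (M * rev N)
    rw [← Sc_rev, rev_mul, rev_rev]
  re_inner_nonneg M := by
    change 0 ≤ Sc (M * rev M)
    rw [Sc_mul_rev]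
    exact Finset.sum_nonneg fun A _ => mul_self_nonneg _
  add_left M N P := by simp [add_mul]
  smul_left M N c := by simp
  definite M hM := by
    have h : ∑ A, coord A M * coord A M = 0 := (Sc_mul_rev M M).symm.trans hM
    rw [Finset.sum_eq_zero_iff_of_nonneg fun A _ => mul_self_nonneg _] at h
    rw [← sum_coord_smul_blade M]
    exact Finset.sum_eq_zero fun A hA => by rw [mul_self_eq_zero.1 (h A hA), zero_smul]

instance : NormedAddCommGroup (Cl n) := innerCore.toNormedAddCommGroup

instance : InnerProductSpace ℝ (Cl n) := .ofCore innerCore.toCore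

instance : MeasurableSpace (Cl n) := borel _

instance : BorelSpace (Cl n) := ⟨rfl⟩

lemma inner_eq (M N : Cl n) : inner ℝ M N = Sc (M * rev N) := rfl

lemma modSq_eq (M : Cl n) : modSq M = ‖M‖ ^ 2 := by
  rw [← real_inner_self_eq_norm_sq]; rfl

lemma norm_sq_eq_sum (M : Cl n) : ‖M‖ ^ 2 = ∑ A, coord A M ^ 2 := by
  rw [← real_inner_self_eq_norm_sq, inner_eq, Sc_mul_rev]
  simp only [sq]

lemma inner_mul_left_eq (M N P : Cl n) : inner ℝ (P * M) N = inner ℝ M (rev P * N) := by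
  rw [inner_eq, inner_eq, rev_mul, rev_rev, mul_assoc, Sc_mul_comm, mul_assoc]

lemma inner_mul_right_eq (M N P : Cl n) : inner ℝ (M * P) N = inner ℝ M (N * rev P) := by
  rw [inner_eq, inner_eq, rev_mul, rev_rev, mul_assoc]

lemma norm_vec_mul (x : E n) (M : Cl n) : ‖vec x * M‖ = ‖x‖ * ‖M‖ := by
  rw [← sq_eq_sq₀ (norm_nonneg _) (by positivity), mul_pow, ← real_inner_self_eq_norm_sq,
    inner_mul_left_eq, rev_vec, ← mul_assoc, vec_mul_self, smul_mul_assoc, one_mul,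
    real_inner_smul_right, real_inner_self_eq_norm_sq]

/-- `coord A` as a continuous linear form. -/
def coordCLM (A : Finset (Fin n)) : Cl n →L[ℝ] ℝ := (coordₗ A).toContinuousLinearMap

/-- The scalar part as a continuous linear form. -/
def scCLM : Cl n →L[ℝ] ℝ := scₗ.toContinuousLinearMap

/-- Reversion as a continuous linear map. -/
def revCLM : Cl n →L[ℝ] Cl n := LinearMap.toContinuousLinearMap CliffordAlgebra.reverse

/-- The grade involution as a continuous linear map. -/
def involuteCLM : Cl n →L[ℝ] Cl n :=
  LinearMap.toContinuousLinearMap CliffordAlgebra.involute.toLinearMap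

/-- The multiplication of `Clₙ` as a continuous bilinear map. -/
def mulCLM : Cl n →L[ℝ] Cl n →L[ℝ] Cl n := (LinearMap.mul ℝ (Cl n)).toContinuousBilinearMap

@[simp] lemma involuteCLM_apply (M : Cl n) : involuteCLM M = CliffordAlgebra.involute M := rfl

@[simp] lemma mulCLM_apply (M N : Cl n) : mulCLM M N = M * N := rfl

instance : ContinuousMul (Cl n) := ⟨mulCLM.isBoundedBilinearMap.continuous⟩

@[fun_prop] lemma continuous_rev : Continuous (rev : Cl n → Cl n) := revCLM.continuous

/-! ### Integration of multivector valued functions -/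

section Integration

variable {X : Type*} [MeasurableSpace X] {μ : Measure X} {F G : X → Cl n}

lemma clIntegrable_iff : ClIntegrable F μ ↔ Integrable F μ := by
  refine ⟨fun h => ?_, fun h A => (coordCLM A).integrable_comp h⟩
  simpa only [sum_coord_smul_blade] using
    integrable_finsetSum Finset.univ fun A _ => (h A).smul_const (blade A)

lemma clIntegral_eq (h : Integrable F μ) : clIntegral μ F = ∫ x, F x ∂μ := by
  rw [clIntegral, ← sum_coord_smul_blade (∫ x, F x ∂μ)]
  refine Finset.sum_congr rfl fun A _ => ?_
  congr 1
  exact (coordCLM A).integral_comp_comm h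

lemma isL2_iff : IsL2 F μ ↔ MemLp F 2 μ := by
  refine ⟨fun h => ?_, fun h A => (coordCLM A).comp_memLp' h⟩
  simpa [Function.comp_def, sum_coord_smul_blade] using memLp_finsetSum Finset.univ fun A _ =>
    (ContinuousLinearMap.toSpanSingleton ℝ (blade A : Cl n)).comp_memLp' (h A)

lemma ofReal_modSq (M : Cl n) : ENNReal.ofReal (modSq M) = ‖M‖ₑ ^ 2 := by
  rw [modSq_eq, ← ofReal_norm, ENNReal.ofReal_pow (norm_nonneg _)]

lemma normSqL2_eq : normSqL2 μ F = ∫⁻ x, ‖F x‖ₑ ^ 2 ∂μ := by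
  simp only [normSqL2, ofReal_modSq]

lemma integrable_mul (hF : MemLp F 2 μ) (hG : MemLp G 2 μ) : Integrable (fun x => F x * G x) μ :=
  memLp_one_iff_integrable.1 (mulCLM.memLp_of_bilin 1 hF hG)

lemma memLp_rev (hF : MemLp F 2 μ) : MemLp (fun x => rev (F x)) 2 μ := revCLM.comp_memLp' hF

lemma innerCl_eq (hF : MemLp F 2 μ) (hG : MemLp G 2 μ) :
    innerCl μ F G = ∫ x, F x * rev (G x) ∂μ :=
  clIntegral_eq (integrable_mul hF (memLp_rev hG))

end Integration

/-! ### Exponential and complex coordinates -/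

lemma continuous_expI : Continuous (expI : ℝ → Cl n) := by
  unfold expI
  fun_prop

@[simp] lemma expI_zero : expI 0 = (1 : Cl n) := by simp [expI]

lemma expI_add (hn : n % 4 = 2 ∨ n % 4 = 3) (s t : ℝ) :
    expI (s + t) = (expI s * expI t : Cl n) := by
  simp only [expI, Real.cos_add, Real.sin_add, add_mul, mul_add, smul_mul_smul_comm, one_mul,
    mul_one, pseudo_mul_self hn]
  module

lemma rev_expI (hn : n % 4 = 2 ∨ n % 4 = 3) (t : ℝ) : rev (expI t : Cl n) = expI (-t) := by
  simp [expI, rev_pseudo hn]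

lemma norm_mul_expI (hn : n % 4 = 2 ∨ n % 4 = 3) (M : Cl n) (t : ℝ) : ‖M * expI t‖ = ‖M‖ := by
  rw [← sq_eq_sq₀ (norm_nonneg _) (norm_nonneg _), ← real_inner_self_eq_norm_sq,
    inner_mul_right_eq, rev_expI hn, mul_assoc, ← expI_add hn, add_neg_cancel, expI_zero, mul_one,
    real_inner_self_eq_norm_sq]

lemma norm_mul_pseudo (hn : n % 4 = 2 ∨ n % 4 = 3) (M : Cl n) : ‖M * pseudo n‖ = ‖M‖ := by
  simpa [expI] using norm_mul_expI hn M (Real.pi / 2)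

/-- The complex coordinates of a multivector, for the complex structure on `Clₙ` given by right
multiplication by `iₙ`. Each real coordinate occurs twice, as the real part of one complex
coordinate and, up to sign, as the imaginary part of another one. -/
def complexCoord : Cl n →L[ℝ] EuclideanSpace ℂ (Finset (Fin n)) :=
  LinearMap.toContinuousLinearMap
    { toFun := fun M => WithLp.toLp 2 fun A => ⟨coordₗ A M, -coordₗ A (M * pseudo n)⟩
      map_add' := fun M N => by
        ext A
        apply Complex.ext <;> simp [add_mul, add_comm]
      map_smul' := fun c M => by
        ext A
        apply Complex.ext <;> simp }

lemma complexCoord_apply (M : Cl n) (A : Finset (Fin n)) :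
    complexCoord M A = ⟨coordₗ A M, -coordₗ A (M * pseudo n)⟩ := rfl

lemma complexCoord_mul_expI (hn : n % 4 = 2 ∨ n % 4 = 3) (M : Cl n) (t : ℝ) :
    complexCoord (M * expI t) = Complex.exp (t * Complex.I) • complexCoord M := by
  have h : M * expI t = Real.cos t • M + Real.sin t • (M * pseudo n) := by
    simp only [expI, mul_add, mul_smul_comm, mul_one]
  have h' : M * expI t * pseudo n = Real.cos t • (M * pseudo n) - Real.sin t • M := by
    simp only [h, add_mul, smul_mul_assoc, mul_assoc, pseudo_mul_self hn, mul_neg, smul_neg,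
      mul_one, sub_eq_add_neg]
  ext A
  rw [complexCoord_apply, h', h, PiLp.smul_apply, complexCoord_apply]
  apply Complex.ext <;>
    simp only [Complex.mul_re, Complex.mul_im, Complex.exp_ofReal_mul_I_re,
      Complex.exp_ofReal_mul_I_im, map_add, map_sub, map_smul, smul_eq_mul] <;>
    ring

lemma norm_complexCoord_sq (hn : n % 4 = 2 ∨ n % 4 = 3) (M : Cl n) :
    ‖complexCoord M‖ ^ 2 = 2 * ‖M‖ ^ 2 := by
  have h (A : Finset (Fin n)) :
      ‖complexCoord M A‖ ^ 2 = coord A M ^ 2 + coord A (M * pseudo n) ^ 2 := by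
    rw [complexCoord_apply, ← Complex.normSq_eq_norm_sq, Complex.normSq_mk]
    simp only [coordₗ_apply]
    ring
  rw [EuclideanSpace.norm_sq_eq, Finset.sum_congr rfl fun A _ => h A, Finset.sum_add_distrib,
    ← norm_sq_eq_sum, ← norm_sq_eq_sum, norm_mul_pseudo hn, two_mul]

lemma norm_complexCoord (hn : n % 4 = 2 ∨ n % 4 = 3) (M : Cl n) :
    ‖complexCoord M‖ = √2 * ‖M‖ := by
  rw [← Real.sqrt_sq (norm_nonneg _), norm_complexCoord_sq hn, Real.sqrt_mul zero_le_two,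
    Real.sqrt_sq (norm_nonneg _)]

lemma norm_mul_expI_sub_le (hn : n % 4 = 2 ∨ n % 4 = 3) (M : Cl n) (t : ℝ) :
    ‖M * expI t - M‖ ≤ |t| * ‖M‖ := by
  have h : ‖complexCoord (M * expI t - M)‖ ≤ |t| * ‖complexCoord M‖ := by
    have hexp : complexCoord (M * expI t - M) = (Complex.exp (t * Complex.I) - 1) •
        complexCoord M := by rw [map_sub, complexCoord_mul_expI hn, sub_smul, one_smul]
    rw [hexp, norm_smul, mul_comm (t : ℂ)]
    gcongr
    exact Real.norm_exp_I_mul_ofReal_sub_one_le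
  rw [norm_complexCoord hn, norm_complexCoord hn, mul_left_comm] at h
  exact le_of_mul_le_mul_left h (by positivity)

/-! ### Plancherel's theorem for integrable functions -/

section Plancherel

variable {V W : Type*} [NormedAddCommGroup V] [InnerProductSpace ℝ V] [FiniteDimensional ℝ V]
  [MeasurableSpace V] [BorelSpace V] [NormedAddCommGroup W] [InnerProductSpace ℂ W]
  [CompleteSpace W] {u : V → W}

open FourierTransform SchwartzMap in
lemma fourier_toLp_ae_eq (h₁ : Integrable u) (h₂ : MemLp u 2) :
    (𝓕 (h₂.toLp u) : Lp W 2 (volume : Measure V)) =ᵐ[volume] 𝓕 u := by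
  have hcont : Continuous (𝓕 u) :=
    VectorFourier.fourierIntegral_continuous Real.continuous_fourierChar
      (by exact continuous_inner) h₁
  refine ae_eq_of_integral_contDiff_smul_eq ((Lp.memLp _).locallyIntegrable (by norm_num))
    hcont.locallyIntegrable fun g hg hgs => ?_
  have hgs' : HasCompactSupport (fun x => (g x : ℂ)) := hgs.comp_left Complex.ofReal_zero
  let φ : 𝓢(V, ℂ) := hgs'.toSchwartzMap (Complex.ofRealCLM.contDiff.comp hg)
  have hφ (x : V) (w : W) : φ x • w = g x • w := Complex.coe_smul (g x) w
  have hdistr : ∫ x, φ x • (𝓕 (h₂.toLp u) : Lp W 2 (volume : Measure V)) x =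
      ∫ x, (𝓕 φ) x • (h₂.toLp u) x := by
    rw [← Lp.toTemperedDistribution_apply, ← Lp.toTemperedDistribution_apply,
      ← Lp.fourier_toTemperedDistribution_eq, TemperedDistribution.fourier_apply]
  have hrepr : ∫ x, (𝓕 φ) x • (h₂.toLp u) x = ∫ x, (𝓕 φ) x • u x :=
    integral_congr_ae (h₂.coeFn_toLp.mono fun x hx => by simp only [hx])
  have hflip := VectorFourier.integral_fourierIntegral_smul_eq_flip (f := φ) (g := u)
    (L := innerₗ V) (μ := volume) (ν := volume) Real.continuous_fourierChar
    (by exact continuous_inner) φ.integrable h₁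
  rw [flip_innerₗ] at hflip
  simp only [← hφ]
  exact (hdistr.trans hrepr).trans hflip

lemma eLpNorm_fourier_eq (h₁ : Integrable u) (h₂ : MemLp u 2) :
    eLpNorm (FourierTransform.fourier u) 2 = eLpNorm u 2 (volume : Measure V) := by
  rw [← eLpNorm_congr_ae (fourier_toLp_ae_eq h₁ h₂), ← eLpNorm_congr_ae h₂.coeFn_toLp,
    ← ENNReal.toReal_eq_toReal_iff' (Lp.eLpNorm_ne_top _) (Lp.eLpNorm_ne_top _), ← Lp.norm_def,
    ← Lp.norm_def, Lp.norm_fourier_eq]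

end Plancherel

lemma eLpNorm_two_sq {X V : Type*} [MeasurableSpace X] [NormedAddCommGroup V] (μ : Measure X)
    (f : X → V) : eLpNorm f 2 μ ^ 2 = ∫⁻ x, ‖f x‖ₑ ^ 2 ∂μ := by
  simpa using eLpNorm_nnreal_pow_eq_lintegral (f := f) (μ := μ) (p := 2) two_ne_zero

lemma eLpNorm_two_comp_of_map_eq_smul {X Y V : Type*} [MeasurableSpace X] [MeasurableSpace Y]
    [NormedAddCommGroup V] {μ : Measure X} {ν : Measure Y} {T : X → Y} {c : ℝ}
    (hT : MeasurableEmbedding T) (hμ : μ.map T = ENNReal.ofReal c • ν) (w : Y → V) :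
    eLpNorm (w ∘ T) 2 μ = ENNReal.ofReal √c * eLpNorm w 2 ν := by
  rw [← hT.eLpNorm_map_measure, hμ, eLpNorm_smul_measure_of_ne_top ENNReal.ofNat_ne_top,
    smul_eq_mul]
  congr 1
  rcases le_total 0 c with hc | hc
  · rw [ENNReal.ofReal_rpow_of_nonneg hc (by norm_num), Real.sqrt_eq_rpow]
    norm_num
  · simp [ENNReal.ofReal_of_nonpos hc, Real.sqrt_eq_zero_of_nonpos hc]

/-- The Fourier integral `∫ u(x) e^{-iₙ ω·x} dx` as a Bochner integral. -/
def cftI (u : E n → Cl n) (ω : E n) : Cl n := ∫ x, u x * expI (-(inner ℝ ω x))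

section

variable {u v : E n → Cl n}

lemma aestronglyMeasurable_mul_expI (hu : AEStronglyMeasurable u) {φ : E n → ℝ}
    (hφ : Continuous φ) : AEStronglyMeasurable (fun x => u x * expI (φ x)) :=
  continuous_mul.comp_aestronglyMeasurable₂ hu (continuous_expI.comp hφ).aestronglyMeasurable

variable (hn : n % 4 = 2 ∨ n % 4 = 3)
include hn

lemma integrable_mul_expI (hu : Integrable u) {φ : E n → ℝ} (hφ : Continuous φ) :
    Integrable (fun x => u x * expI (φ x)) :=
  hu.mono (aestronglyMeasurable_mul_expI hu.1 hφ)
    (Eventually.of_forall fun _ => (norm_mul_expI hn _ _).le)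

lemma memLp_mul_expI (hu : MemLp u 2) {φ : E n → ℝ} (hφ : Continuous φ) :
    MemLp (fun x => u x * expI (φ x)) 2 :=
  hu.of_le (aestronglyMeasurable_mul_expI hu.1 hφ)
    (Eventually.of_forall fun _ => (norm_mul_expI hn _ _).le)

lemma integrable_cftI_integrand (hu : Integrable u) (ω : E n) :
    Integrable fun x => u x * expI (-(inner ℝ ω x)) :=
  integrable_mul_expI hn hu (by fun_prop)

lemma cftIntegral_eq (hu : Integrable u) : cftIntegral u = cftI u :=
  funext fun ω => clIntegral_eq (integrable_cftI_integrand hn hu ω)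

lemma continuous_cftI (hu : Integrable u) : Continuous (cftI u) := by
  refine continuous_of_dominated (bound := fun x => ‖u x‖)
    (fun ω => (integrable_cftI_integrand hn hu ω).1)
    (fun ω => Eventually.of_forall fun x => (norm_mul_expI hn _ _).le) hu.norm
    (Eventually.of_forall fun x => ?_)
  exact continuous_const.mul (continuous_expI.comp (by fun_prop))

lemma cftI_add (hu : Integrable u) (hv : Integrable v) : cftI (u + v) = cftI u + cftI v := by
  ext1 ω
  simp only [cftI, Pi.add_apply, add_mul]
  exact integral_add (integrable_cftI_integrand hn hu ω) (integrable_cftI_integrand hn hv ω)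

lemma cftI_sub (hu : Integrable u) (hv : Integrable v) : cftI (u - v) = cftI u - cftI v := by
  ext1 ω
  simp only [cftI, Pi.sub_apply, sub_mul]
  exact integral_sub (integrable_cftI_integrand hn hu ω) (integrable_cftI_integrand hn hv ω)

lemma complexCoord_cftI (hu : Integrable u) (ω : E n) :
    complexCoord (cftI u ω) =
      FourierTransform.fourier (fun x => complexCoord (u x)) ((2 * Real.pi)⁻¹ • ω) := by
  rw [cftI, ← complexCoord.integral_comp_comm (integrable_cftI_integrand hn hu ω),
    Real.fourier_eq']
  refine integral_congr_ae (Eventually.of_forall fun x => ?_)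
  simp only [complexCoord_mul_expI hn]
  congr 4
  rw [inner_smul_right, real_inner_comm]
  field [Real.pi_ne_zero]

/-- Because right multiplication by `e^{iₙ t}` acts on complex coordinates as the scalar
`e^{it}`, this is the scalar Plancherel theorem; the constant comes from the normalization
`e^{-2πi ω·x}` of the scalar transform. -/
lemma eLpNorm_cftI (h₁ : Integrable u) (h₂ : MemLp u 2) :
    eLpNorm (cftI u) 2 = ENNReal.ofReal √((2 * Real.pi) ^ n) * eLpNorm u 2 := by
  have hmap : (volume : Measure (E n)).map ((2 * Real.pi)⁻¹ • ·) =
      ENNReal.ofReal ((2 * Real.pi) ^ n) • volume := by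
    rw [Measure.map_addHaar_smul _ (by positivity), finrank_euclideanSpace, Fintype.card_fin,
      inv_pow, inv_inv, abs_of_pos (by positivity)]
  have hemb : MeasurableEmbedding ((2 * Real.pi)⁻¹ • · : E n → E n) :=
    measurableEmbedding_const_smul₀ (by positivity)
  have hcoord (w : E n → Cl n) :
      eLpNorm (fun x => complexCoord (w x)) 2 = ENNReal.ofReal √2 * eLpNorm w 2 := by
    rw [← Real.enorm_of_nonneg (Real.sqrt_nonneg 2), ← eLpNorm_const_smul]
    refine eLpNorm_congr_norm_ae (Eventually.of_forall fun x => ?_)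
    rw [norm_complexCoord hn, Pi.smul_apply, norm_smul, Real.norm_of_nonneg (Real.sqrt_nonneg 2)]
  have hplancherel : eLpNorm (fun ω => complexCoord (cftI u ω)) 2 =
      ENNReal.ofReal √((2 * Real.pi) ^ n) * eLpNorm (fun x => complexCoord (u x)) 2 := by
    rw [← eLpNorm_fourier_eq (complexCoord.integrable_comp h₁) (complexCoord.comp_memLp' h₂),
      ← eLpNorm_two_comp_of_map_eq_smul hemb hmap]
    exact congrArg (eLpNorm · 2 volume) (funext (complexCoord_cftI hn h₁))
  rw [hcoord, hcoord, mul_left_comm] at hplancherel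
  exact (ENNReal.mul_right_inj (by simp) ENNReal.ofReal_ne_top).1 hplancherel

lemma memLp_cftI (h₁ : Integrable u) (h₂ : MemLp u 2) : MemLp (cftI u) 2 := by
  refine ⟨(continuous_cftI hn h₁).aestronglyMeasurable, ?_⟩
  rw [eLpNorm_cftI hn h₁ h₂]
  exact ENNReal.mul_lt_top ENNReal.ofReal_lt_top h₂.2

end

/-! ### The Clifford Fourier transform on `L²` -/

lemma tendsto_zero_of_le_const_mul {ι : Type*} {l : Filter ι} {x y : ι → ℝ≥0∞} {c : ℝ≥0∞}
    (hc : c ≠ ⊤) (hy : Tendsto y l (𝓝 0)) (h : ∀ i, x i ≤ c * y i) : Tendsto x l (𝓝 0) :=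
  tendsto_of_tendsto_of_tendsto_of_le_of_le tendsto_const_nhds
    (by simpa using ENNReal.Tendsto.const_mul hy (Or.inr hc)) (fun _ => zero_le) h

/-- `F` is the Fourier–Plancherel transform of `f`: the pair `(f, F)` lies in the `L²` closure of
the graph of the Fourier integral on `L¹ ∩ L²`. Unlike `IsCFT`, this does not single out the
truncations to balls, which makes it stable under translations and dilations. -/
structure IsL2CFT (f F : E n → Cl n) : Prop where
  memLp_left : MemLp f 2
  memLp_right : MemLp F 2
  exists_seq : ∃ u : ℕ → E n → Cl n, (∀ k, Integrable (u k)) ∧ (∀ k, MemLp (u k) 2) ∧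
    Tendsto (fun k => eLpNorm (u k - f) 2) atTop (𝓝 0) ∧
    Tendsto (fun k => eLpNorm (cftI (u k) - F) 2) atTop (𝓝 0)

namespace IsL2CFT

variable {f F g G : E n → Cl n}

lemma map (h : IsL2CFT f F) {T S : (E n → Cl n) → E n → Cl n} {c d : ℝ≥0∞} (hc : c ≠ ⊤)
    (hd : d ≠ ⊤) (hT₁ : ∀ u, Integrable u → Integrable (T u)) (hT₂ : ∀ u, MemLp u 2 → MemLp (T u) 2)
    (hS₂ : ∀ u, MemLp u 2 → MemLp (S u) 2)
    (hT : ∀ u v, eLpNorm (T u - T v) 2 ≤ c * eLpNorm (u - v) 2)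
    (hS : ∀ u v, eLpNorm (S u - S v) 2 ≤ d * eLpNorm (u - v) 2)
    (hTS : ∀ u, Integrable u → cftI (T u) = S (cftI u)) : IsL2CFT (T f) (S F) := by
  obtain ⟨u, hu₁, hu₂, huf, huF⟩ := h.exists_seq
  refine ⟨hT₂ f h.memLp_left, hS₂ F h.memLp_right, fun k => T (u k), fun k => hT₁ _ (hu₁ k),
    fun k => hT₂ _ (hu₂ k), tendsto_zero_of_le_const_mul hc huf fun k => hT _ _,
    tendsto_zero_of_le_const_mul hd huF fun k => ?_⟩
  rw [hTS _ (hu₁ k)]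
  exact hS _ _

lemma congr_left (h : IsL2CFT f F) (hfg : f =ᵐ[volume] g) : IsL2CFT g F := by
  obtain ⟨u, hu₁, hu₂, huf, huF⟩ := h.exists_seq
  refine ⟨h.memLp_left.ae_eq hfg, h.memLp_right, u, hu₁, hu₂, huf.congr fun k => ?_, huF⟩
  exact eLpNorm_congr_ae (EventuallyEq.rfl.sub hfg)

lemma congr_right (h : IsL2CFT f F) (hFG : F =ᵐ[volume] G) : IsL2CFT f G := by
  obtain ⟨u, hu₁, hu₂, huf, huF⟩ := h.exists_seq
  refine ⟨h.memLp_left, h.memLp_right.ae_eq hFG, u, hu₁, hu₂, huf, huF.congr fun k => ?_⟩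
  exact eLpNorm_congr_ae (EventuallyEq.rfl.sub hFG)

variable (hn : n % 4 = 2 ∨ n % 4 = 3)
include hn

lemma add (h : IsL2CFT f F) (h' : IsL2CFT g G) : IsL2CFT (f + g) (F + G) := by
  obtain ⟨u, hu₁, hu₂, huf, huF⟩ := h.exists_seq
  obtain ⟨v, hv₁, hv₂, hvg, hvG⟩ := h'.exists_seq
  refine ⟨h.memLp_left.add h'.memLp_left, h.memLp_right.add h'.memLp_right, fun k => u k + v k,
    fun k => (hu₁ k).add (hv₁ k), fun k => (hu₂ k).add (hv₂ k),
    tendsto_zero_of_le_const_mul ENNReal.one_ne_top (by simpa using huf.add hvg) fun k => ?_,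
    tendsto_zero_of_le_const_mul ENNReal.one_ne_top (by simpa using huF.add hvG) fun k => ?_⟩
  · rw [add_sub_add_comm, one_mul]
    exact eLpNorm_add_le ((hu₂ k).sub h.memLp_left).1 ((hv₂ k).sub h'.memLp_left).1 one_le_two
  · rw [cftI_add hn (hu₁ k) (hv₁ k), add_sub_add_comm, one_mul]
    exact eLpNorm_add_le ((memLp_cftI hn (hu₁ k) (hu₂ k)).sub h.memLp_right).1
      ((memLp_cftI hn (hv₁ k) (hv₂ k)).sub h'.memLp_right).1 one_le_two

lemma clm_comp (h : IsL2CFT f F) (L : Cl n →L[ℝ] Cl n)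
    (hL : ∀ M t, L (M * expI t) = L M * expI t) :
    IsL2CFT (fun x => L (f x)) (fun x => L (F x)) := by
  have hbound (u v : E n → Cl n) :
      eLpNorm ((fun x => L (u x)) - fun x => L (v x)) 2 ≤
        ENNReal.ofReal ‖L‖ * eLpNorm (u - v) 2 :=
    eLpNorm_le_mul_eLpNorm_of_ae_le_mul (Eventually.of_forall fun x => by
      simpa only [Pi.sub_apply, map_sub] using L.le_opNorm (u x - v x)) 2
  refine h.map (T := fun u x => L (u x)) (S := fun u x => L (u x)) ENNReal.ofReal_ne_top
    ENNReal.ofReal_ne_top (fun u hu => L.integrable_comp hu) (fun u hu => L.comp_memLp' hu)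
    (fun u hu => L.comp_memLp' hu) hbound hbound fun u hu => ?_
  ext1 ω
  simp only [cftI, ← hL]
  exact L.integral_comp_comm (integrable_cftI_integrand hn hu ω)

lemma sub (h : IsL2CFT f F) (h' : IsL2CFT g G) : IsL2CFT (f - g) (F - G) := by
  have hneg : IsL2CFT (-g) (-G) := h'.clm_comp hn (-ContinuousLinearMap.id ℝ _) fun M t => by simp
  rw [sub_eq_add_neg, sub_eq_add_neg]
  exact h.add hn hneg

lemma eLpNorm_eq (h : IsL2CFT f F) :
    eLpNorm F 2 = ENNReal.ofReal √((2 * Real.pi) ^ n) * eLpNorm f 2 := by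
  obtain ⟨u, hu₁, hu₂, huf, huF⟩ := h.exists_seq
  have hlimf := ((Lp.tendsto_Lp_iff_tendsto_eLpNorm'' u hu₂ f h.memLp_left).2 huf).enorm
  have hlimF := ((Lp.tendsto_Lp_iff_tendsto_eLpNorm'' (fun k => cftI (u k))
    (fun k => memLp_cftI hn (hu₁ k) (hu₂ k)) F h.memLp_right).2 huF).enorm
  simp only [Lp.enorm_toLp, eLpNorm_cftI hn (hu₁ _) (hu₂ _)] at hlimf hlimF
  exact tendsto_nhds_unique hlimF
    (ENNReal.Tendsto.const_mul hlimf (Or.inr ENNReal.ofReal_ne_top))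

lemma ae_eq (h : IsL2CFT f F) (h' : IsL2CFT f G) : F =ᵐ[volume] G := by
  have hdiff := (h.sub hn h').eLpNorm_eq hn
  rw [sub_self, eLpNorm_zero, mul_zero,
    eLpNorm_eq_zero_iff (h.memLp_right.sub h'.memLp_right).1 two_ne_zero] at hdiff
  filter_upwards [hdiff] with x hx
  exact sub_eq_zero.1 hx

lemma integral_norm_sq (h : IsL2CFT f F) :
    ∫ ω, ‖F ω‖ ^ 2 = (2 * Real.pi) ^ n * ∫ x, ‖f x‖ ^ 2 := by
  have hsq (g : E n → Cl n) (hg : MemLp g 2) :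
      ∫ x, ‖g x‖ ^ 2 = (eLpNorm g 2 volume ^ 2).toReal := by
    rw [integral_eq_lintegral_of_nonneg_ae (Eventually.of_forall fun _ => by positivity)
      hg.norm.integrable_sq.1, eLpNorm_two_sq]
    simp only [ENNReal.ofReal_pow (norm_nonneg _), ofReal_norm]
  rw [hsq F h.memLp_right, hsq f h.memLp_left, h.eLpNorm_eq hn, mul_pow,
    ← ENNReal.ofReal_pow (Real.sqrt_nonneg _), Real.sq_sqrt (by positivity), ENNReal.toReal_mul,
    ENNReal.toReal_ofReal (by positivity)]

lemma integral_inner (h : IsL2CFT f F) (h' : IsL2CFT g G) :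
    ∫ ω, inner ℝ (F ω) (G ω) = (2 * Real.pi) ^ n * ∫ x, inner ℝ (f x) (g x) := by
  have polarization {u v : E n → Cl n} (hu : MemLp u 2) (hv : MemLp v 2) :
      ∫ x, inner ℝ (u x) (v x) = ((∫ x, ‖(u + v) x‖ ^ 2) - ∫ x, ‖(u - v) x‖ ^ 2) / 4 := by
    rw [← integral_sub (hu.add hv).norm.integrable_sq (hu.sub hv).norm.integrable_sq,
      ← integral_div]
    refine integral_congr_ae (Eventually.of_forall fun x => ?_)
    simp only [Pi.add_apply, Pi.sub_apply]
    rw [norm_add_sq_real, norm_sub_sq_real]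
    ring
  rw [polarization h.memLp_right h'.memLp_right, polarization h.memLp_left h'.memLp_left,
    (h.add hn h').integral_norm_sq hn, (h.sub hn h').integral_norm_sq hn]
  ring

lemma integral_mul_rev (h : IsL2CFT f F) (h' : IsL2CFT g G) :
    ∫ ω, F ω * rev (G ω) = (2 * Real.pi) ^ n • ∫ x, f x * rev (g x) := by
  refine ext_inner_left ℝ fun N => ?_
  have hadj (a b : Cl n) : inner ℝ N (a * rev b) = inner ℝ a (N * b) := by
    rw [real_inner_comm, inner_mul_right_eq, rev_rev]
  rw [inner_smul_right,
    ← _root_.integral_inner (integrable_mul h.memLp_right (memLp_rev h'.memLp_right)),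
    ← _root_.integral_inner (integrable_mul h.memLp_left (memLp_rev h'.memLp_left))]
  simp only [hadj]
  exact h.integral_inner hn (h'.clm_comp hn (mulCLM N) fun M t => (mul_assoc N M _).symm)

end IsL2CFT

section Existence

variable {f F : E n → Cl n}

lemma tendsto_sq_nhds_zero_iff {ι : Type*} {l : Filter ι} {x : ι → ℝ≥0∞} :
    Tendsto (fun i => x i ^ 2) l (𝓝 0) ↔ Tendsto x l (𝓝 0) := by
  have hroot (y : ℝ≥0∞) : (y ^ 2) ^ (1 / 2 : ℝ) = y := by
    rw [← ENNReal.rpow_natCast, ← ENNReal.rpow_mul]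
    norm_num
  refine ⟨fun h => ?_, fun h => by simpa using ENNReal.Tendsto.pow (n := 2) h⟩
  simpa only [hroot, ENNReal.zero_rpow_of_pos one_half_pos] using h.ennrpow_const (1 / 2)

lemma integrable_indicator_ball (hf : MemLp f 2) (R : ℝ) :
    Integrable ((Metric.ball (0 : E n) R).indicator f) := by
  rw [integrable_indicator_iff measurableSet_ball]
  have : IsFiniteMeasure (volume.restrict (Metric.ball (0 : E n) R)) :=
    ⟨by simpa using measure_ball_lt_top⟩
  exact (hf.restrict _).integrable one_le_two

lemma memLp_indicator_ball (hf : MemLp f 2) (R : ℝ) :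
    MemLp ((Metric.ball (0 : E n) R).indicator f) 2 := hf.indicator measurableSet_ball

lemma tendsto_indicator_ball (hf : MemLp f 2) :
    Tendsto (fun R : ℝ => eLpNorm ((Metric.ball (0 : E n) R).indicator f - f) 2) atTop (𝓝 0) := by
  rw [← tendsto_sq_nhds_zero_iff]
  simp only [eLpNorm_two_sq]
  rw [← lintegral_zero (μ := (volume : Measure (E n)))]
  refine tendsto_lintegral_filter_of_dominated_convergence' (fun x => ‖f x‖ₑ ^ 2)
    (Eventually.of_forall fun R => ?_)
    (Eventually.of_forall fun R => Eventually.of_forall fun x => ?_) ?_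
    (Eventually.of_forall fun x => ?_)
  · exact ((memLp_indicator_ball hf R).sub hf).1.aemeasurable.enorm.pow_const 2
  · gcongr
    by_cases hx : x ∈ Metric.ball (0 : E n) R <;> simp [hx]
  · rw [← eLpNorm_two_sq]
    exact ENNReal.pow_ne_top hf.2.ne
  · refine tendsto_const_nhds.congr' ?_
    filter_upwards [eventually_gt_atTop ‖x‖] with R hR
    have hx : x ∈ Metric.ball (0 : E n) R := by simpa using hR
    simp [hx]

variable (hn : n % 4 = 2 ∨ n % 4 = 3)
include hn

lemma exists_tendsto_cftI {ι : Type*} {l : Filter ι} [l.NeBot] {u : ι → E n → Cl n}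
    (h₁ : ∀ i, Integrable (u i)) (h₂ : ∀ i, MemLp (u i) 2) (hf : MemLp f 2)
    (h : Tendsto (fun i => eLpNorm (u i - f) 2) l (𝓝 0)) :
    ∃ F : E n → Cl n, MemLp F 2 ∧ Tendsto (fun i => eLpNorm (cftI (u i) - F) 2) l (𝓝 0) := by
  let U (i : ι) : Lp (Cl n) 2 (volume : Measure (E n)) := (h₂ i).toLp (u i)
  let V (i : ι) : Lp (Cl n) 2 (volume : Measure (E n)) :=
    (memLp_cftI hn (h₁ i) (h₂ i)).toLp (cftI (u i))
  have hdist (i j : ι) : dist (V i) (V j) = √((2 * Real.pi) ^ n) * dist (U i) (U j) := by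
    rw [dist_eq_norm, dist_eq_norm, ← MemLp.toLp_sub, ← MemLp.toLp_sub, Lp.norm_toLp,
      Lp.norm_toLp, ← cftI_sub hn (h₁ i) (h₁ j),
      eLpNorm_cftI hn ((h₁ i).sub (h₁ j)) ((h₂ i).sub (h₂ j)), ENNReal.toReal_mul,
      ENNReal.toReal_ofReal (Real.sqrt_nonneg _)]
  have hU : Cauchy (Filter.map U l) :=
    ((Lp.tendsto_Lp_iff_tendsto_eLpNorm'' u h₂ f hf).2 h).cauchy_map
  have hV : Cauchy (Filter.map V l) := by
    rw [cauchy_map_iff, tendsto_uniformity_iff_dist_tendsto_zero] at hU ⊢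
    refine ⟨inferInstance, ?_⟩
    simp only [hdist]
    simpa using hU.2.const_mul √((2 * Real.pi) ^ n)
  obtain ⟨F, hF⟩ := CompleteSpace.complete hV
  refine ⟨F, Lp.memLp F, (Lp.tendsto_Lp_iff_tendsto_eLpNorm'' (fun i => cftI (u i))
    (fun i => memLp_cftI hn (h₁ i) (h₂ i)) F (Lp.memLp F)).1 ?_⟩
  rw [Lp.toLp_coeFn]
  exact hF

lemma isCFT_iff (hf : MemLp f 2) :
    IsCFT f F ↔ MemLp F 2 ∧ Tendsto (fun R : ℝ =>
      eLpNorm (cftI ((Metric.ball (0 : E n) R).indicator f) - F) 2) atTop (𝓝 0) := by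
  rw [IsCFT, isL2_iff]
  refine and_congr_right fun _ => Iff.trans ?_ tendsto_sq_nhds_zero_iff
  simp only [normSqL2_eq, cftIntegral_eq hn (integrable_indicator_ball hf _), eLpNorm_two_sq,
    Pi.sub_apply, enorm_sub_rev]

lemma exists_isCFT (hf : MemLp f 2) : ∃ F, IsCFT f F := by
  simp only [isCFT_iff hn hf]
  exact exists_tendsto_cftI hn (integrable_indicator_ball hf) (memLp_indicator_ball hf) hf
    (tendsto_indicator_ball hf)

lemma IsCFT.isL2CFT (hf : MemLp f 2) (h : IsCFT f F) : IsL2CFT f F := by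
  obtain ⟨hF, hlim⟩ := (isCFT_iff hn hf).1 h
  exact ⟨hf, hF, fun k => (Metric.ball (0 : E n) k).indicator f,
    fun k => integrable_indicator_ball hf k, fun k => memLp_indicator_ball hf k,
    (tendsto_indicator_ball hf).comp tendsto_natCast_atTop_atTop,
    hlim.comp tendsto_natCast_atTop_atTop⟩

lemma isL2CFT_cft (hf : MemLp f 2) : IsL2CFT f (cft f) :=
  IsCFT.isL2CFT hn hf (Classical.epsilon_spec (exists_isCFT hn hf))

end Existence

/-! ### Similitudes -/

/-- A rotation as a linear isometry. -/
def rotE (r : SO n) : E n ≃ₗᵢ[ℝ] E n where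
  toFun := rot r
  map_add' x y := by ext i; simp [rot, Matrix.mulVec_add]
  map_smul' c x := by ext i; simp [rot, Matrix.mulVec_smul]
  invFun := rot r⁻¹
  left_inv x := by
    have h : (r⁻¹ : SO n).1 * r.1 = 1 := congrArg Subtype.val (inv_mul_cancel r)
    simp [rot, Matrix.mulVec_mulVec, h]
  right_inv x := by
    have h : r.1 * (r⁻¹ : SO n).1 = 1 := congrArg Subtype.val (mul_inv_cancel r)
    simp [rot, Matrix.mulVec_mulVec, h]
  norm_map' x := by
    have horth : r.1.transpose * r.1 = 1 :=
      (Matrix.mem_orthogonalGroup_iff' (Fin n) ℝ).1 (Matrix.mem_specialOrthogonalGroup_iff.1 r.2).1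
    have hsq (y : E n) : ‖y‖ ^ 2 = y.ofLp ⬝ᵥ y.ofLp := by
      rw [EuclideanSpace.norm_sq_eq]; simp [dotProduct, sq]
    change ‖rot r x‖ = ‖x‖
    rw [← sq_eq_sq₀ (norm_nonneg _) (norm_nonneg _), hsq, hsq, rot, Matrix.dotProduct_mulVec,
      Matrix.vecMul_mulVec, horth, Matrix.vecMul_one]

@[simp] lemma rotE_apply (r : SO n) (x : E n) : rotE r x = rot r x := rfl

lemma rot_rot_inv (r : SO n) (x : E n) : rot r (rot r⁻¹ x) = x := (rotE r).apply_symm_apply x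

lemma inner_rot_right (r : SO n) (x y : E n) : inner ℝ x (rot r y) = inner ℝ (rot r⁻¹ x) y := by
  rw [← (rotE r).inner_map_map (rot r⁻¹ x) y, rotE_apply, rotE_apply, rot_rot_inv]

/-- The similitude `x ↦ r⁻¹(c (x - b))` of `ℝⁿ`. With `c = a⁻¹` it is the substitution in the
daughter wavelet `ψ_{a,r,b}`; with `c = a` and `b = 0`, the one in the Fourier transform of
`ψ_{a,r,b}`. -/
def simil (c : ℝ) (r : SO n) (b x : E n) : E n := rot r⁻¹ (c • (x - b))

lemma simil_zero (c : ℝ) (r : SO n) (x : E n) : simil c r 0 x = c • rot r⁻¹ x := by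
  rw [simil, sub_zero, ← rotE_apply, ← rotE_apply, map_smul]

lemma smul_rot_simil_inv {a : ℝ} (ha : a ≠ 0) (r : SO n) (b x : E n) :
    a • rot r (simil a⁻¹ r b x) + b = x := by
  rw [simil, rot_rot_inv, smul_inv_smul₀ ha, sub_add_cancel]

section Similitude

variable {c : ℝ} (hc : c ≠ 0) (r : SO n) (b : E n)
include hc

lemma measurableEmbedding_simil : MeasurableEmbedding (simil c r b) :=
  (rotE r).symm.toHomeomorph.measurableEmbedding.comp
    ((measurableEmbedding_const_smul₀ hc).comp (MeasurableEquiv.subRight b).measurableEmbedding)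

lemma map_volume_simil :
    (volume : Measure (E n)).map (simil c r b) = ENNReal.ofReal |(c ^ n)⁻¹| • volume := by
  have hcomp : simil c r b = (rotE r).symm ∘ (c • ·) ∘ (· - b) := rfl
  rw [hcomp, ← Measure.map_map (by fun_prop) (by fun_prop),
    ← Measure.map_map (by fun_prop) (by fun_prop), (measurePreserving_sub_right volume b).map_eq,
    Measure.map_addHaar_smul _ hc, finrank_euclideanSpace, Fintype.card_fin, Measure.map_smul,
    (rotE r).symm.measurePreserving.map_eq]

lemma quasiMeasurePreserving_simil : Measure.QuasiMeasurePreserving (simil c r b) :=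
  ⟨(measurableEmbedding_simil hc r b).measurable,
    map_volume_simil hc r b ▸ Measure.smul_absolutelyContinuous⟩

variable {W : Type*} [NormedAddCommGroup W]

lemma eLpNorm_comp_simil (w : E n → W) :
    eLpNorm (fun x => w (simil c r b x)) 2 = ENNReal.ofReal √|(c ^ n)⁻¹| * eLpNorm w 2 :=
  eLpNorm_two_comp_of_map_eq_smul (measurableEmbedding_simil hc r b) (map_volume_simil hc r b) w

lemma integrable_comp_simil {w : E n → W} (hw : Integrable w) :
    Integrable (fun x => w (simil c r b x)) := by
  refine (measurableEmbedding_simil hc r b).integrable_map_iff.1 ?_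
  rw [map_volume_simil hc]
  exact hw.smul_measure ENNReal.ofReal_ne_top

lemma memLp_comp_simil {w : E n → W} (hw : MemLp w 2) : MemLp (fun x => w (simil c r b x)) 2 := by
  refine ⟨hw.1.comp_quasiMeasurePreserving (quasiMeasurePreserving_simil hc r b), ?_⟩
  rw [eLpNorm_comp_simil hc]
  exact ENNReal.mul_lt_top ENNReal.ofReal_lt_top hw.2

lemma integral_comp_simil [NormedSpace ℝ W] (w : E n → W) :
    ∫ x, w (simil c r b x) = |(c ^ n)⁻¹| • ∫ x, w x := by
  rw [← (measurableEmbedding_simil hc r b).integral_map, map_volume_simil hc,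
    integral_smul_measure, ENNReal.toReal_ofReal (abs_nonneg _)]

end Similitude

section

variable {a : ℝ} (r : SO n) (b : E n) (hn : n % 4 = 2 ∨ n % 4 = 3)
include hn

lemma cftI_comp_simil_inv (ha : a ≠ 0) {u : E n → Cl n} (hu : Integrable u) (ω : E n) :
    cftI (fun x => u (simil a⁻¹ r b x)) ω =
      |a ^ n| • (cftI u (simil a r 0 ω) * expI (-inner ℝ ω b)) := by
  have hphase (y : E n) : -inner ℝ ω (a • rot r y + b) =
      -inner ℝ (simil a r 0 ω) y + -inner ℝ ω b := by
    rw [inner_add_right, inner_smul_right, inner_rot_right, simil_zero, inner_smul_left,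
      neg_add, conj_trivial]
  have hsubst := integral_comp_simil (inv_ne_zero ha) r b
    (fun y => u y * expI (-inner ℝ ω (a • rot r y + b)))
  simp only [smul_rot_simil_inv ha, hphase, expI_add hn, ← mul_assoc, inv_pow, inv_inv] at hsubst
  rw [cftI, hsubst]
  congr 1
  exact (mulCLM.flip (expI (-inner ℝ ω b))).integral_comp_comm
    (integrable_cftI_integrand hn hu _)

lemma IsL2CFT.comp_simil_inv (ha : a ≠ 0) {f F : E n → Cl n} (h : IsL2CFT f F) :
    IsL2CFT (fun x => f (simil a⁻¹ r b x))
      (fun ω => |a ^ n| • (F (simil a r 0 ω) * expI (-inner ℝ ω b))) := by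
  refine h.map (T := fun u x => u (simil a⁻¹ r b x))
    (S := fun u ω => |a ^ n| • (u (simil a r 0 ω) * expI (-inner ℝ ω b)))
    (d := ‖|a ^ n|‖ₑ * ENNReal.ofReal √|(a ^ n)⁻¹|)
    ENNReal.ofReal_ne_top (ENNReal.mul_ne_top enorm_ne_top ENNReal.ofReal_ne_top)
    (fun u hu => integrable_comp_simil (inv_ne_zero ha) r b hu)
    (fun u hu => memLp_comp_simil (inv_ne_zero ha) r b hu)
    (fun u hu => (memLp_mul_expI hn (memLp_comp_simil ha r 0 hu)
      (φ := fun ω => -inner ℝ ω b) (by fun_prop)).const_smul |a ^ n|)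
    (fun u v => (eLpNorm_comp_simil (inv_ne_zero ha) r b (u - v)).le)
    (fun u v => le_of_eq ?_)
    fun u hu => funext (cftI_comp_simil_inv r b hn ha hu)
  rw [mul_assoc, ← eLpNorm_comp_simil ha r 0, ← eLpNorm_const_smul]
  refine eLpNorm_congr_norm_ae (Eventually.of_forall fun ω => ?_)
  simp only [Pi.sub_apply, Pi.smul_apply, ← smul_sub, ← sub_mul, norm_smul, norm_mul_expI hn]

lemma IsL2CFT.daughter (ha : 0 < a) {ψ Ψ : E n → Cl n} (h : IsL2CFT ψ Ψ) :
    IsL2CFT (daughter ψ ((a, r), b))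
      (fun ω => a ^ ((n : ℝ) / 2) • (Ψ (a • rot r⁻¹ ω) * expI (-inner ℝ ω b))) := by
  have hpow : (a ^ ((n : ℝ) / 2))⁻¹ * a ^ n = a ^ ((n : ℝ) / 2) := by
    rw [inv_mul_eq_iff_eq_mul₀ (Real.rpow_pos_of_pos ha _).ne', ← Real.rpow_add ha, add_halves,
      Real.rpow_natCast]
  have hsmul := (h.comp_simil_inv r b hn ha.ne').clm_comp hn
    ((a ^ ((n : ℝ) / 2))⁻¹ • ContinuousLinearMap.id ℝ (Cl n)) (fun M t => by simp)
  simp only [_root_.smul_apply, ContinuousLinearMap.id_apply, smul_smul, simil_zero,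
    abs_of_pos (pow_pos ha n), hpow] at hsmul
  exact hsmul

lemma smul_waveletTransform_eq (ha : 0 < a) {f F ψ Ψ : E n → Cl n} (hf : IsL2CFT f F)
    (hψ : IsL2CFT ψ Ψ) :
    (2 * Real.pi) ^ n • waveletTransform ψ f ((a, r), b) =
      ∫ ω, F ω * expI (inner ℝ ω b) * rev (a ^ ((n : ℝ) / 2) • Ψ (a • rot r⁻¹ ω)) := by
  have hd := hψ.daughter r b hn ha
  rw [waveletTransform, innerCl_eq hf.memLp_left hd.memLp_left, ← hf.integral_mul_rev hn hd]
  simp only [rev_smul, rev_mul, rev_expI hn, neg_neg, mul_smul_comm, mul_assoc]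

end

/-! ### Uncertainty from Lipschitz translations -/

lemma mul_comp_eq_of_translation {S : Type*} {ξ : S → ℝ} {τ : S → S} {t : ℝ}
    (hξτ : ∀ s, ξ (τ s) = ξ s + t) (N : S → ℝ) : ξ * N ∘ τ = (ξ * N) ∘ τ - t • N ∘ τ := by
  ext s
  simp only [Pi.mul_apply, Function.comp_apply, Pi.sub_apply, Pi.smul_apply, smul_eq_mul, hξτ]
  ring

section Translation

variable {S : Type*} [MeasurableSpace S] {m : Measure S}

section Real

variable {N ξ : S → ℝ} {τ : S → S} {t : ℝ} (hτ : MeasurePreserving τ m m)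
  (hξτ : ∀ s, ξ (τ s) = ξ s + t) (hN : MemLp N 2 m) (hξ : MemLp (ξ * N) 2 m)
include hτ hξτ hN hξ

lemma memLp_mul_comp_of_translation : MemLp (ξ * N ∘ τ) 2 m := by
  rw [mul_comp_eq_of_translation hξτ]
  exact (hξ.comp_measurePreserving hτ).sub ((hN.comp_measurePreserving hτ).const_smul t)

lemma eLpNorm_mul_comp_le_of_translation :
    eLpNorm (ξ * N ∘ τ) 2 m ≤ eLpNorm (ξ * N) 2 m + ‖t‖ₑ * eLpNorm N 2 m := by
  have hNτ := hN.comp_measurePreserving hτ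
  rw [mul_comp_eq_of_translation hξτ]
  refine (eLpNorm_sub_le (hξ.comp_measurePreserving hτ).1 (hNτ.const_smul t).1
    one_le_two).trans_eq ?_
  rw [eLpNorm_comp_measurePreserving hξ.1 hτ, eLpNorm_const_smul,
    eLpNorm_comp_measurePreserving hN.1 hτ]

lemma mul_integral_sq_eq_of_translation :
    t * ∫ s, N s ^ 2 ∂m = ∫ s, ((N - N ∘ τ) • (ξ * N + ξ * N ∘ τ)) s ∂m := by
  have hNτ := hN.comp_measurePreserving hτ
  have hξNτ := memLp_mul_comp_of_translation hτ hξτ hN hξ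
  have hshift : ∫ s, (ξ s + t) * N (τ s) ^ 2 ∂m = ∫ s, ξ s * N s ^ 2 ∂m := by
    have hmeas : AEStronglyMeasurable (fun s => ξ s * N s ^ 2) (m.map τ) :=
      hτ.map_eq.symm ▸ (hξ.1.mul hN.1).congr
        (Eventually.of_forall fun s => by simp only [Pi.mul_apply]; ring)
    simpa only [hτ.map_eq, hξτ] using (integral_map hτ.aemeasurable hmeas).symm
  have hint₁ : Integrable (fun s => ξ s * N s ^ 2) m := by
    simpa only [Pi.mul_def, mul_assoc, sq] using hξ.integrable_mul hN
  have hint₂ : Integrable (fun s => ξ s * N (τ s) ^ 2) m := by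
    simpa only [Pi.mul_def, Function.comp_apply, mul_assoc, sq] using hξNτ.integrable_mul hNτ
  have hint₃ : Integrable (fun s => t * N (τ s) ^ 2) m := hNτ.integrable_sq.const_mul t
  have hinv : ∫ s, N (τ s) ^ 2 ∂m = ∫ s, N s ^ 2 ∂m := by
    have hmeas : AEStronglyMeasurable (fun s => N s ^ 2) (m.map τ) :=
      hτ.map_eq.symm ▸ hN.1.pow 2
    simpa only [hτ.map_eq] using (integral_map hτ.aemeasurable hmeas).symm
  simp only [add_mul] at hshift
  rw [integral_add hint₂ hint₃, integral_const_mul, hinv] at hshift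
  rw [eq_sub_of_add_eq' hshift, ← integral_sub hint₁ hint₂]
  refine integral_congr_ae (Eventually.of_forall fun s => ?_)
  simp only [smul_eq_mul, Pi.mul_apply, Pi.sub_apply, Pi.add_apply, Function.comp_apply]
  ring

lemma enorm_mul_eLpNorm_sq_le_of_translation :
    ‖t‖ₑ * eLpNorm N 2 m ^ 2 ≤
      eLpNorm (N - N ∘ τ) 2 m * (2 * eLpNorm (ξ * N) 2 m + ‖t‖ₑ * eLpNorm N 2 m) := by
  have hξNτ := memLp_mul_comp_of_translation hτ hξτ hN hξ
  have hsq : eLpNorm N 2 m ^ 2 = ‖∫ s, N s ^ 2 ∂m‖ₑ := by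
    rw [Real.enorm_of_nonneg (integral_nonneg fun s => sq_nonneg _),
      ofReal_integral_eq_lintegral_ofReal hN.integrable_sq (Eventually.of_forall fun s =>
        sq_nonneg _), eLpNorm_two_sq]
    exact lintegral_congr fun s => by
      rw [Real.enorm_eq_ofReal_abs, ← ENNReal.ofReal_pow (abs_nonneg _), sq_abs]
  calc ‖t‖ₑ * eLpNorm N 2 m ^ 2
      = ‖∫ s, ((N - N ∘ τ) • (ξ * N + ξ * N ∘ τ)) s ∂m‖ₑ := by
        rw [hsq, ← enorm_mul, mul_integral_sq_eq_of_translation hτ hξτ hN hξ]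
    _ ≤ eLpNorm ((N - N ∘ τ) • (ξ * N + ξ * N ∘ τ)) 1 m := by
        rw [eLpNorm_one_eq_lintegral_enorm]
        exact enorm_integral_le_lintegral_enorm _
    _ ≤ eLpNorm (N - N ∘ τ) 2 m * eLpNorm (ξ * N + ξ * N ∘ τ) 2 m :=
        eLpNorm_smul_le_mul_eLpNorm (hξ.1.add hξNτ.1) (hN.1.sub (hN.comp_measurePreserving hτ).1)
    _ ≤ eLpNorm (N - N ∘ τ) 2 m * (2 * eLpNorm (ξ * N) 2 m + ‖t‖ₑ * eLpNorm N 2 m) := by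
        rw [two_mul, add_assoc]
        gcongr
        exact (eLpNorm_add_le hξ.1 hξNτ.1 one_le_two).trans
          (by gcongr; exact eLpNorm_mul_comp_le_of_translation hτ hξτ hN hξ)

end Real

variable {W : Type*} [NormedAddCommGroup W] {H : S → W} {ξ : S → ℝ} {τ : ℝ → S → S}
  (hτ : ∀ t, MeasurePreserving (τ t) m m) (hξτ : ∀ t s, ξ (τ t s) = ξ s + t)
include hτ hξτ

lemma eLpNorm_sq_le_of_lipschitz_translation (hH : MemLp H 2 m)
    (hξ : MemLp (fun s => ξ s * ‖H s‖) 2 m) {κ : ℝ≥0∞} (hκ : κ ≠ ⊤)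
    (hlip : ∀ t > 0, eLpNorm (fun s => H (τ t s) - H s) 2 m ≤ ENNReal.ofReal t * κ) :
    eLpNorm H 2 m ^ 2 ≤ 2 * κ * eLpNorm (fun s => ξ s * ‖H s‖) 2 m := by
  set Z := eLpNorm H 2 m
  set Y := eLpNorm (fun s => ξ s * ‖H s‖) 2 m
  have hbound : ∀ t : ℝ, 0 < t → Z ^ 2 ≤ κ * (2 * Y + ENNReal.ofReal t * Z) := fun t ht => by
    have hnorm : eLpNorm ((‖H ·‖) - (‖H ·‖) ∘ τ t) 2 m ≤ ENNReal.ofReal t * κ :=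
      (eLpNorm_mono fun s => by
        simpa only [Pi.sub_apply, Function.comp_apply, norm_sub_rev (H s), Real.norm_eq_abs]
          using abs_norm_sub_norm_le (H s) (H (τ t s))).trans (hlip t ht)
    have hmul := enorm_mul_eLpNorm_sq_le_of_translation (hτ t) (hξτ t) hH.norm hξ
    rw [Real.enorm_of_nonneg ht.le, eLpNorm_norm] at hmul
    rw [← ENNReal.mul_le_mul_iff_right (ENNReal.ofReal_pos.2 ht).ne' ENNReal.ofReal_ne_top,
      ← mul_assoc]
    exact hmul.trans (by gcongr; exact le_rfl)
  have hlim : Tendsto (fun t : ℝ => κ * (2 * Y + ENNReal.ofReal t * Z)) (𝓝[>] 0)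
      (𝓝 (κ * (2 * Y + ENNReal.ofReal 0 * Z))) := by
    refine (ENNReal.Tendsto.const_mul (tendsto_const_nhds.add (ENNReal.Tendsto.mul_const
      (ENNReal.continuous_ofReal.tendsto 0) (Or.inr hH.2.ne))) (Or.inr hκ)).mono_left
        nhdsWithin_le_nhds
  refine (ge_of_tendsto hlim (eventually_nhdsWithin_of_forall hbound)).trans_eq ?_
  rw [ENNReal.ofReal_zero, zero_mul, add_zero]
  ring

lemma lintegral_sq_le_of_lipschitz_translation (hH : AEStronglyMeasurable H m)
    (hξ : AEStronglyMeasurable ξ m) (hZ : ∫⁻ s, ‖H s‖ₑ ^ 2 ∂m ≠ ⊤)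
    (hY : ∫⁻ s, ‖ξ s‖ₑ ^ 2 * ‖H s‖ₑ ^ 2 ∂m ≠ ⊤) {K : ℝ≥0∞} (hK : K ≠ ⊤)
    (hlip : ∀ t > 0, ∫⁻ s, ‖H (τ t s) - H s‖ₑ ^ 2 ∂m ≤ ENNReal.ofReal t ^ 2 * K) :
    (∫⁻ s, ‖H s‖ₑ ^ 2 ∂m) ^ 2 ≤ 4 * K * ∫⁻ s, ‖ξ s‖ₑ ^ 2 * ‖H s‖ₑ ^ 2 ∂m := by
  have hκ : (K ^ (2⁻¹ : ℝ)) ^ 2 = K := by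
    rw [← ENNReal.rpow_natCast, ← ENNReal.rpow_mul]; norm_num
  have hprod : ∫⁻ s, ‖ξ s‖ₑ ^ 2 * ‖H s‖ₑ ^ 2 ∂m = eLpNorm (fun s => ξ s * ‖H s‖) 2 m ^ 2 := by
    rw [eLpNorm_two_sq]
    exact lintegral_congr fun s => by rw [enorm_mul, mul_pow, enorm_norm]
  rw [hprod] at hY ⊢
  rw [← eLpNorm_two_sq] at hZ ⊢
  simp only [ne_eq, ENNReal.pow_eq_top_iff, two_ne_zero, not_false_eq_true, and_true] at hY hZ
  have h := eLpNorm_sq_le_of_lipschitz_translation hτ hξτ ⟨hH, Ne.lt_top hZ⟩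
    ⟨hξ.mul hH.norm, Ne.lt_top hY⟩ (κ := K ^ (2⁻¹ : ℝ))
    (ENNReal.rpow_ne_top_of_nonneg (by positivity) hK)
    fun t ht => by
      rw [← (ENNReal.pow_right_strictMono two_ne_zero).le_iff_le, eLpNorm_two_sq, mul_pow, hκ]
      exact hlip t ht
  refine (pow_le_pow_left' h 2).trans_eq ?_
  rw [mul_pow, mul_pow, hκ]
  norm_num

end Translation

section

variable (hn : n % 4 = 2 ∨ n % 4 = 3) {h : E n → Cl n} (h₁ : Integrable h) (h₂ : MemLp h 2)
include hn h₁

lemma cftI_translate (v b : E n) :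
    cftI (fun ω => h (ω + v)) b = cftI h b * expI (inner ℝ b v) := by
  have hsubst := integral_add_right_eq_self (μ := volume)
    (fun ω => h ω * expI (-inner ℝ b (ω - v))) v
  simp only [add_sub_cancel_right, inner_sub_right, neg_sub', sub_neg_eq_add, expI_add hn,
    ← mul_assoc] at hsubst
  rw [cftI, hsubst]
  exact (mulCLM.flip (expI (inner ℝ b v))).integral_comp_comm (integrable_cftI_integrand hn h₁ b)

include h₂

lemma lintegral_cftI_sq :
    ∫⁻ b, ‖cftI h b‖ₑ ^ 2 = ENNReal.ofReal ((2 * Real.pi) ^ n) * ∫⁻ ω, ‖h ω‖ₑ ^ 2 := by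
  rw [← eLpNorm_two_sq, ← eLpNorm_two_sq, eLpNorm_cftI hn h₁ h₂, mul_pow,
    ← ENNReal.ofReal_pow (Real.sqrt_nonneg _), Real.sq_sqrt (by positivity)]

lemma lintegral_translate_sub_sq_le (v : E n) :
    ENNReal.ofReal ((2 * Real.pi) ^ n) * ∫⁻ ω, ‖h (ω + v) - h ω‖ₑ ^ 2 ≤
      ∫⁻ b, ‖(inner ℝ b v : ℝ)‖ₑ ^ 2 * ‖cftI h b‖ₑ ^ 2 := by
  have hv₁ : Integrable (fun ω => h (ω + v)) := h₁.comp_add_right v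
  have hv₂ : MemLp (fun ω => h (ω + v)) 2 :=
    h₂.comp_measurePreserving (measurePreserving_add_right volume v)
  have hplanch := lintegral_cftI_sq hn (hv₁.sub h₁) (hv₂.sub h₂)
  simp only [Pi.sub_apply] at hplanch
  rw [← hplanch, cftI_sub hn hv₁ h₁]
  refine lintegral_mono fun b => ?_
  rw [Pi.sub_apply, cftI_translate hn h₁, ← mul_pow, ← enorm_norm (cftI h b), ← enorm_mul]
  refine pow_le_pow_left' (enorm_le_iff_norm_le.2 ?_) 2
  simpa using norm_mul_expI_sub_le hn (cftI h b) (inner ℝ b v)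

end

/-! ### The similitude group -/

lemma isClosed_specialOrthogonalGroup :
    IsClosed (Matrix.specialOrthogonalGroup (Fin n) ℝ : Set (Matrix (Fin n) (Fin n) ℝ)) :=
  isClosed_unitary.inter (isClosed_eq continuous_id.matrix_det continuous_const)

instance : SecondCountableTopology (SO n) :=
  haveI : SecondCountableTopology (Matrix (Fin n) (Fin n) ℝ) :=
    inferInstanceAs (SecondCountableTopology (Fin n → Fin n → ℝ))
  IsInducing.subtypeVal.secondCountableTopology

instance : SigmaCompactSpace (SO n) :=
  haveI : SigmaCompactSpace (Matrix (Fin n) (Fin n) ℝ) :=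
    inferInstanceAs (SigmaCompactSpace (Fin n → Fin n → ℝ))
  isClosed_specialOrthogonalGroup.isClosedEmbedding_subtypeVal.sigmaCompactSpace

lemma measurable_smul_rot_inv : Measurable fun q : (ℝ × SO n) × E n => q.1.1 • rot q.1.2⁻¹ q.2 := by
  have hinv : Continuous fun q : (ℝ × SO n) × E n => (q.1.2⁻¹).1 :=
    (continuous_subtype_val.comp (continuous_snd.comp continuous_fst)).matrix_transpose
  exact ((continuous_fst.comp continuous_fst).smul ((PiLp.continuous_toLp 2 _).comp
    (hinv.matrix_mulVec ((PiLp.continuous_ofLp 2 _).comp continuous_snd)))).measurable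

section

variable (ν : Measure (SO n))

instance [SFinite ν] : SFinite (dilRotMeasure ν) := by unfold dilRotMeasure; infer_instance

lemma ae_dilRotMeasure_pos : ∀ᵐ p ∂dilRotMeasure ν, 0 < p.1 := by
  unfold dilRotMeasure
  refine Measure.quasiMeasurePreserving_fst.ae (p := fun a => 0 < a) ?_
  exact (withDensity_absolutelyContinuous _ _).ae_le (ae_restrict_mem measurableSet_Ioi)

lemma ae_ae_smul_rot_inv [SFinite ν] {p : E n → Prop} (hp : ∀ᵐ x, p x) :
    ∀ᵐ ω : E n, ∀ᵐ g ∂dilRotMeasure ν, p (g.1 • rot g.2⁻¹ ω) := by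
  obtain ⟨s, hs, hsm, hs₀⟩ := exists_measurable_superset_of_null (ae_iff.1 hp)
  have horbit : ∀ᵐ g ∂dilRotMeasure ν, ∀ᵐ ω : E n, g.1 • rot g.2⁻¹ ω ∉ s := by
    filter_upwards [ae_dilRotMeasure_pos ν] with g hg
    simpa only [simil_zero] using
      (quasiMeasurePreserving_simil hg.ne' g.2 0).ae (compl_mem_ae_iff.2 hs₀)
  have hmeas : MeasurableSet {q : (ℝ × SO n) × E n | q.1.1 • rot q.1.2⁻¹ q.2 ∉ s} :=
    measurable_smul_rot_inv hsm.compl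
  filter_upwards [(Measure.ae_ae_comm hmeas).1 horbit] with ω hω
  filter_upwards [hω] with g hg
  exact not_not.1 fun h => hg (hs h)

end

/-! ### Parity -/

/-- `M` commutes (`ε = 1`) or anticommutes (`ε = -1`) with the pseudoscalar. -/
def PseudoCommute (ε : ℤˣ) (M : Cl n) : Prop := pseudo n * M = ε • (M * pseudo n)

namespace PseudoCommute

variable {ε : ℤˣ} {M : Cl n}

lemma expI_mul (h : PseudoCommute ε M) (t : ℝ) : expI t * M = M * expI (ε • t) := by
  unfold PseudoCommute at h
  simp only [expI, add_mul, mul_add, smul_mul_assoc, mul_smul_comm, one_mul, mul_one, h]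
  rcases Int.units_eq_one_or ε with rfl | rfl <;> simp

lemma rev (hn : n % 4 = 2 ∨ n % 4 = 3) (h : PseudoCommute ε M) : PseudoCommute ε (rev M) := by
  have hrev := congrArg CliffordWavelet.rev h
  rcases Int.units_eq_one_or ε with rfl | rfl <;>
    simpa [PseudoCommute, rev_mul, rev_neg, rev_pseudo hn, eq_comm, neg_eq_iff_eq_neg] using hrev

lemma commute_rev_mul_self (hn : n % 4 = 2 ∨ n % 4 = 3) (h : PseudoCommute ε M) :
    Commute (CliffordWavelet.rev M * M) (pseudo n) := by
  have hrev := h.rev hn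
  unfold PseudoCommute at h hrev
  rw [commute_iff_eq, mul_assoc, ← mul_assoc (pseudo n), hrev, smul_mul_assoc,
    mul_assoc (CliffordWavelet.rev M) (pseudo n), h, mul_smul_comm, smul_smul]
  rcases Int.units_eq_one_or ε with rfl | rfl <;> simp

end PseudoCommute

lemma isClosed_setOf_pseudoCommute (ε : ℤˣ) : IsClosed {M : Cl n | PseudoCommute ε M} := by
  rcases Int.units_eq_one_or ε with rfl | rfl <;> simp only [PseudoCommute, one_smul]
  · exact isClosed_eq (by fun_prop) (by fun_prop)
  · exact isClosed_eq (by fun_prop) (by fun_prop)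

lemma involute_expI (hn : Even n) (t : ℝ) :
    CliffordAlgebra.involute (expI t : Cl n) = expI t := by
  simp [expI, involute_pseudo hn]

lemma pseudoCommute_of_involute_eq (hn₀ : n ≠ 0) (hn : Even n) {ε : ℤˣ} {M : Cl n}
    (h : CliffordAlgebra.involute M = ε • M) : PseudoCommute ε M := by
  rw [PseudoCommute, mul_pseudo_of_even hn₀ hn, h]
  rcases Int.units_eq_one_or ε with rfl | rfl <;> simp

lemma pseudoCommute_one_of_odd (hn : Odd n) (M : Cl n) : PseudoCommute 1 M := by
  rw [PseudoCommute, one_smul, mul_pseudo_of_odd hn]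

lemma HasParity.exists_involute_eq {ψ : E n → Cl n} (h : HasParity ψ) :
    ∃ ε : ℤˣ, ∀ᵐ x, CliffordAlgebra.involute (ψ x) = ε • ψ x := by
  rcases h with heven | hodd
  · exact ⟨1, heven.mono fun x hx => by
      rw [one_smul]; exact CliffordAlgebra.involute_eq_of_mem_even hx⟩
  · exact ⟨-1, hodd.mono fun x hx => by
      rw [Units.neg_smul, one_smul]; exact CliffordAlgebra.involute_eq_of_mem_odd hx⟩

lemma IsL2CFT.exists_pseudoCommute (hn : n % 4 = 2 ∨ n % 4 = 3) {ψ Ψ : E n → Cl n}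
    (h : IsL2CFT ψ Ψ) (hpar : n % 4 = 2 → HasParity ψ) :
    ∃ ε : ℤˣ, ∀ᵐ ω, PseudoCommute ε (Ψ ω) := by
  by_cases hn₂ : n % 4 = 2
  · have heven : Even n := Nat.even_iff.2 (by omega)
    obtain ⟨ε, hψ⟩ := (hpar hn₂).exists_involute_eq
    have hinv := h.clm_comp hn involuteCLM fun M t => by simp [involute_expI heven]
    have hsign := h.clm_comp hn (ε • ContinuousLinearMap.id ℝ (Cl n)) fun M t => by
      rcases Int.units_eq_one_or ε with rfl | rfl <;> simp
    refine ⟨ε, ((hinv.congr_left hψ).ae_eq hn hsign).mono fun ω hω => ?_⟩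
    exact pseudoCommute_of_involute_eq (by omega) heven hω
  · exact ⟨1, Eventually.of_forall fun ω =>
      pseudoCommute_one_of_odd (Nat.odd_iff.2 (by omega)) _⟩

lemma exists_measurable_pseudoCommute {ε : ℤˣ} {Ψ : E n → Cl n} (hΨ : AEStronglyMeasurable Ψ)
    (h : ∀ᵐ ω, PseudoCommute ε (Ψ ω)) :
    ∃ Ψ' : E n → Cl n, Measurable Ψ' ∧ Ψ =ᵐ[volume] Ψ' ∧ ∀ ω, PseudoCommute ε (Ψ' ω) := by
  obtain ⟨Φ, hΦ, hΨΦ⟩ := hΨ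
  let s := {ω | PseudoCommute ε (Φ ω)}
  have hs : MeasurableSet s := hΦ.measurable (isClosed_setOf_pseudoCommute ε).measurableSet
  refine ⟨s.indicator Φ, hΦ.measurable.indicator hs, ?_, fun ω => ?_⟩
  · filter_upwards [hΨΦ, h] with ω hω hcomm
    have hmem : ω ∈ s := show PseudoCommute ε (Φ ω) by rwa [← hω]
    rw [Set.indicator_of_mem hmem, hω]
  · by_cases hω : ω ∈ s
    · rwa [Set.indicator_of_mem hω]
    · simp [Set.indicator_of_notMem hω, PseudoCommute]

/-! ### Heisenberg's inequality for a measurable family -/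

lemma ae_apply_ne_zero (k : Fin n) : ∀ᵐ x : E n, x k ≠ 0 := by
  let T : E n →ₗ[ℝ] ℝ := (EuclideanSpace.proj k : E n →L[ℝ] ℝ).toLinearMap
  have hT : LinearMap.ker T ≠ ⊤ := fun h => by
    have hmem : EuclideanSpace.single k (1 : ℝ) ∈ LinearMap.ker T := h ▸ Submodule.mem_top
    simp [T] at hmem
  have hker : ((LinearMap.ker T : Submodule ℝ (E n)) : Set (E n)) = {x | x k = 0} := by
    ext x; simp [T]
  simpa [ae_iff, hker] using Measure.addHaar_submodule volume (LinearMap.ker T) hT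

lemma enorm_sq_eq_sum (x : E n) : ‖x‖ₑ ^ 2 = ∑ k, ‖x k‖ₑ ^ 2 := by
  simp only [← ofReal_norm, ← ENNReal.ofReal_pow (norm_nonneg _)]
  rw [← ENNReal.ofReal_sum_of_nonneg fun _ _ => sq_nonneg _, EuclideanSpace.norm_sq_eq]

lemma card_sq_mul_le_sum_mul_sum {ι : Type*} [Fintype ι] {a : ℝ≥0∞} {x y : ι → ℝ≥0∞}
    (h : ∀ i, a ≤ x i * y i) : (Fintype.card ι : ℝ≥0∞) ^ 2 * a ≤ (∑ i, x i) * ∑ i, y i := by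
  have sqrt_sq (t : ℝ≥0∞) : (t ^ (1 / 2 : ℝ)) ^ (2 : ℝ) = t := by
    rw [← ENNReal.rpow_mul]; norm_num
  have cauchySchwarz : ∑ i, x i ^ (1 / 2 : ℝ) * y i ^ (1 / 2 : ℝ) ≤
      (∑ i, x i) ^ (1 / 2 : ℝ) * (∑ i, y i) ^ (1 / 2 : ℝ) := by
    simpa only [sqrt_sq] using ENNReal.inner_le_Lp_mul_Lq Finset.univ
      (fun i => x i ^ (1 / 2 : ℝ)) (fun i => y i ^ (1 / 2 : ℝ)) Real.HolderConjugate.two_two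
  have sum_sqrt_le : Fintype.card ι * a ^ (1 / 2 : ℝ) ≤
      ((∑ i, x i) * ∑ i, y i) ^ (1 / 2 : ℝ) := by
    rw [ENNReal.mul_rpow_of_nonneg _ _ (by norm_num)]
    refine le_trans ?_ cauchySchwarz
    rw [← nsmul_eq_mul, ← Finset.card_univ]
    refine Finset.card_nsmul_le_sum _ _ _ fun i _ => ?_
    rw [← ENNReal.mul_rpow_of_nonneg _ _ (by norm_num)]
    exact ENNReal.rpow_le_rpow (h i) (by norm_num)
  simpa only [ENNReal.mul_rpow_of_nonneg _ _ (zero_le_two (α := ℝ)), sqrt_sq,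
    ENNReal.rpow_two] using ENNReal.rpow_le_rpow sum_sqrt_le (zero_le_two (α := ℝ))

section Family

variable {P : Type*} [MeasurableSpace P] {μ : Measure P}

/-- The partial Fourier integral of a function on `P × ℝⁿ` in its second variable. -/
def partialCftI (H : P × E n → Cl n) (q : P × E n) : Cl n := cftI (fun ω => H (q.1, ω)) q.2

lemma measurable_partialCftI {H : P × E n → Cl n} (hH : Measurable H) :
    Measurable (partialCftI H) := by
  have hint : Measurable fun z : (P × E n) × E n =>
      H (z.1.1, z.2) * expI (-inner ℝ z.1.2 z.2) :=
    (hH.comp (by fun_prop)).mul (continuous_expI.measurable.comp (by fun_prop))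
  exact (hint.stronglyMeasurable.integral_prod_right' (ν := (volume : Measure (E n)))).measurable

lemma ae_memLp_slice {H : P × E n → Cl n} (hH : Measurable H)
    (hZ : ∫⁻ q, ‖H q‖ₑ ^ 2 ∂μ.prod volume ≠ ⊤) : ∀ᵐ p ∂μ, MemLp (fun ω => H (p, ω)) 2 := by
  have hm : Measurable fun q => ‖H q‖ₑ ^ 2 := hH.enorm.pow_const 2
  rw [lintegral_prod _ hm.aemeasurable] at hZ
  filter_upwards [ae_lt_top hm.lintegral_prod_right' hZ] with p hp
  refine ⟨(hH.comp measurable_prodMk_left).aestronglyMeasurable, ?_⟩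
  rw [← eLpNorm_two_sq] at hp
  exact (ENNReal.pow_lt_top_iff.1 hp).resolve_right two_ne_zero

lemma lintegral_eq_zero_of_coord_sq_mul {N : P × E n → ℝ≥0∞} (hN : Measurable N)
    (k : Fin n) (h : ∫⁻ q : P × E n, ‖q.2 k‖ₑ ^ 2 * N q ∂μ.prod volume = 0) :
    ∫⁻ q, N q ∂μ.prod volume = 0 := by
  have hm : Measurable fun q : P × E n => ‖q.2 k‖ₑ ^ 2 * N q := by fun_prop
  rw [lintegral_eq_zero_iff hm] at h
  rw [lintegral_eq_zero_iff hN]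
  have hk : ∀ᵐ q ∂μ.prod (volume : Measure (E n)), q.2 k ≠ 0 :=
    Measure.quasiMeasurePreserving_snd.ae (ae_apply_ne_zero k)
  filter_upwards [h, hk] with q hq hqk
  exact (mul_eq_zero.1 hq).resolve_left (pow_ne_zero 2 (enorm_ne_zero.2 hqk))

lemma lintegral_enorm_sq_mul_eq_sum {N : P × E n → ℝ≥0∞} (hN : Measurable N) :
    ∫⁻ q, ‖q.2‖ₑ ^ 2 * N q ∂μ.prod volume =
      ∑ k, ∫⁻ q : P × E n, ‖q.2 k‖ₑ ^ 2 * N q ∂μ.prod volume := by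
  rw [← lintegral_finsetSum _ fun k _ => by fun_prop]
  simp only [enorm_sq_eq_sum, Finset.sum_mul]

variable (hn : n % 4 = 2 ∨ n % 4 = 3) {H : P × E n → Cl n} (hH : Measurable H)
    (hi : ∀ᵐ p ∂μ, Integrable fun ω => H (p, ω))
    (hZ : ∫⁻ q, ‖H q‖ₑ ^ 2 ∂μ.prod volume ≠ ⊤)
include hn hH hi hZ

lemma lintegral_partialCftI_sq :
    ∫⁻ q, ‖partialCftI H q‖ₑ ^ 2 ∂μ.prod volume =
      ENNReal.ofReal ((2 * Real.pi) ^ n) * ∫⁻ q, ‖H q‖ₑ ^ 2 ∂μ.prod volume := by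
  rw [lintegral_prod _ ((measurable_partialCftI hH).enorm.pow_const 2).aemeasurable,
    lintegral_prod _ (hH.enorm.pow_const 2).aemeasurable,
    ← lintegral_const_mul' _ _ ENNReal.ofReal_ne_top]
  refine lintegral_congr_ae ?_
  filter_upwards [hi, ae_memLp_slice hH hZ] with p hp₁ hp₂
  simp only [partialCftI]
  exact lintegral_cftI_sq hn hp₁ hp₂

lemma lintegral_translate_slices_sub_sq_le (k : Fin n) (t : ℝ) :
    ENNReal.ofReal ((2 * Real.pi) ^ n) *
        ∫⁻ q, ‖H (q.1, q.2 + t • EuclideanSpace.single k (1 : ℝ)) - H q‖ₑ ^ 2 ∂μ.prod volume ≤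
      ‖t‖ₑ ^ 2 * ∫⁻ q : P × E n, ‖q.2 k‖ₑ ^ 2 * ‖partialCftI H q‖ₑ ^ 2 ∂μ.prod volume := by
  have hFm := measurable_partialCftI hH
  rw [lintegral_prod _ (by fun_prop), lintegral_prod _ (by fun_prop),
    ← lintegral_const_mul' _ _ ENNReal.ofReal_ne_top,
    ← lintegral_const_mul' _ _ (by simp)]
  refine lintegral_mono_ae ?_
  filter_upwards [hi, ae_memLp_slice hH hZ] with p hp₁ hp₂
  refine (lintegral_translate_sub_sq_le hn hp₁ hp₂ _).trans_eq ?_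
  rw [← lintegral_const_mul' _ _ (by simp)]
  refine lintegral_congr fun b => ?_
  simp only [real_inner_smul_right, EuclideanSpace.inner_single_right, enorm_mul, partialCftI]
  simp [mul_pow, mul_assoc]

variable [SFinite μ]

lemma partial_uncertainty_coord_of_ne_top (k : Fin n)
    (hX : ∫⁻ q : P × E n, ‖q.2 k‖ₑ ^ 2 * ‖partialCftI H q‖ₑ ^ 2 ∂μ.prod volume ≠ ⊤)
    (hY : ∫⁻ q : P × E n, ‖q.2 k‖ₑ ^ 2 * ‖H q‖ₑ ^ 2 ∂μ.prod volume ≠ ⊤) :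
    ENNReal.ofReal ((2 * Real.pi) ^ n) * (∫⁻ q, ‖H q‖ₑ ^ 2 ∂μ.prod volume) ^ 2 ≤
      4 * (∫⁻ q : P × E n, ‖q.2 k‖ₑ ^ 2 * ‖partialCftI H q‖ₑ ^ 2 ∂μ.prod volume) *
        ∫⁻ q : P × E n, ‖q.2 k‖ₑ ^ 2 * ‖H q‖ₑ ^ 2 ∂μ.prod volume := by
  set X := ∫⁻ q : P × E n, ‖q.2 k‖ₑ ^ 2 * ‖partialCftI H q‖ₑ ^ 2 ∂μ.prod volume
  set Y := ∫⁻ q : P × E n, ‖q.2 k‖ₑ ^ 2 * ‖H q‖ₑ ^ 2 ∂μ.prod volume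
  set c := ENNReal.ofReal ((2 * Real.pi) ^ n) with hc
  have hc₀ : c ≠ 0 := by rw [hc, Ne, ENNReal.ofReal_eq_zero, not_le]; positivity
  have hc_top : c ≠ ⊤ := ENNReal.ofReal_ne_top
  have hτ (t : ℝ) : MeasurePreserving
      (fun q : P × E n => (q.1, q.2 + t • EuclideanSpace.single k (1 : ℝ)))
      (μ.prod volume) (μ.prod volume) :=
    (MeasurePreserving.id μ).prod (measurePreserving_add_right volume _)
  have hlip : ∀ t > 0, ∫⁻ q, ‖H (q.1, q.2 + t • EuclideanSpace.single k (1 : ℝ)) - H q‖ₑ ^ 2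
      ∂μ.prod volume ≤ ENNReal.ofReal t ^ 2 * (c⁻¹ * X) := fun t ht => by
    rw [mul_left_comm, ← ENNReal.div_eq_inv_mul, ENNReal.le_div_iff_mul_le (.inl hc₀)
      (.inl hc_top), mul_comm, ← Real.enorm_of_nonneg ht.le]
    exact lintegral_translate_slices_sub_sq_le hn hH hi hZ k t
  have h := lintegral_sq_le_of_lipschitz_translation (ξ := fun q : P × E n => q.2 k) hτ
    (fun t q => by simp) hH.aestronglyMeasurable (by fun_prop) hZ hY
    (ENNReal.mul_ne_top (ENNReal.inv_ne_top.2 hc₀) hX) hlip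
  calc c * (∫⁻ q, ‖H q‖ₑ ^ 2 ∂μ.prod volume) ^ 2 ≤ c * (4 * (c⁻¹ * X) * Y) := by gcongr
    _ = (c * c⁻¹) * (4 * X * Y) := by ring
    _ = 4 * X * Y := by rw [ENNReal.mul_inv_cancel hc₀ hc_top, one_mul]

lemma partial_uncertainty_coord (k : Fin n) :
    ENNReal.ofReal ((2 * Real.pi) ^ n) * (∫⁻ q, ‖H q‖ₑ ^ 2 ∂μ.prod volume) ^ 2 ≤
      4 * (∫⁻ q : P × E n, ‖q.2 k‖ₑ ^ 2 * ‖partialCftI H q‖ₑ ^ 2 ∂μ.prod volume) *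
        ∫⁻ q : P × E n, ‖q.2 k‖ₑ ^ 2 * ‖H q‖ₑ ^ 2 ∂μ.prod volume := by
  have hπ : ENNReal.ofReal ((2 * Real.pi) ^ n) ≠ 0 := by
    rw [Ne, ENNReal.ofReal_eq_zero, not_le]; positivity
  have hPlancherel := lintegral_partialCftI_sq hn hH hi hZ
  by_cases hX₀ : ∫⁻ q : P × E n, ‖q.2 k‖ₑ ^ 2 * ‖partialCftI H q‖ₑ ^ 2 ∂μ.prod volume = 0
  · rw [lintegral_eq_zero_of_coord_sq_mul ((measurable_partialCftI hH).enorm.pow_const 2) k hX₀]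
      at hPlancherel
    simp [(mul_eq_zero.1 hPlancherel.symm).resolve_left hπ]
  by_cases hY₀ : ∫⁻ q : P × E n, ‖q.2 k‖ₑ ^ 2 * ‖H q‖ₑ ^ 2 ∂μ.prod volume = 0
  · simp [lintegral_eq_zero_of_coord_sq_mul (hH.enorm.pow_const 2) k hY₀]
  by_cases hX : ∫⁻ q : P × E n, ‖q.2 k‖ₑ ^ 2 * ‖partialCftI H q‖ₑ ^ 2 ∂μ.prod volume = ⊤
  · simp [hX, ENNReal.mul_top, ENNReal.top_mul, hY₀]
  by_cases hY : ∫⁻ q : P × E n, ‖q.2 k‖ₑ ^ 2 * ‖H q‖ₑ ^ 2 ∂μ.prod volume = ⊤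
  · simp [hY, ENNReal.mul_top, hX₀]
  exact partial_uncertainty_coord_of_ne_top hn hH hi hZ k hX hY

lemma partial_uncertainty :
    (n : ℝ≥0∞) ^ 2 *
        (ENNReal.ofReal ((2 * Real.pi) ^ n) * (∫⁻ q, ‖H q‖ₑ ^ 2 ∂μ.prod volume) ^ 2) ≤
      4 * (∫⁻ q, ‖q.2‖ₑ ^ 2 * ‖partialCftI H q‖ₑ ^ 2 ∂μ.prod volume) *
        ∫⁻ q, ‖q.2‖ₑ ^ 2 * ‖H q‖ₑ ^ 2 ∂μ.prod volume := by
  rw [lintegral_enorm_sq_mul_eq_sum ((measurable_partialCftI hH).enorm.pow_const 2),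
    lintegral_enorm_sq_mul_eq_sum (hH.enorm.pow_const 2)]
  simpa only [Fintype.card_fin, ← Finset.mul_sum] using
    card_sq_mul_le_sum_mul_sum (partial_uncertainty_coord hn hH hi hZ)

end Family

/-! ### The wavelet transform on the Fourier side -/

/-- The symbol `F(ω) (a^{n/2} Ψ(a r⁻¹ ω))~` of the wavelet transform: for fixed `(a, r)` and up to
the sign of `b`, it is the Fourier transform of `b ↦ T_ψ f(a, r, b)` when `F`, `Ψ` are those of
`f`, `ψ`. -/
def waveletSymbol (F Ψ : E n → Cl n) (q : (ℝ × SO n) × E n) : Cl n :=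
  F q.2 * rev (q.1.1 ^ ((n : ℝ) / 2) • Ψ (q.1.1 • rot q.1.2⁻¹ q.2))

/-- The integrand `aⁿ Ψ(a r⁻¹ ω)~ Ψ(a r⁻¹ ω)` of the admissibility constant, for an arbitrary
function `Ψ` in place of `ψ̂`. -/
def calderonIntegrand (Ψ : E n → Cl n) (ω : E n) (p : ℝ × SO n) : Cl n :=
  p.1 ^ n • (rev (Ψ (p.1 • rot p.2⁻¹ ω)) * Ψ (p.1 • rot p.2⁻¹ ω))

/-- Calderón's condition on the Fourier side, in terms of the Bochner integral: the integral
defining the admissibility constant equals `C` for almost every frequency. -/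
def CalderonCondition (ν : Measure (SO n)) (Ψ : E n → Cl n) (C : Cl n) : Prop :=
  ∀ᵐ ω : E n, Integrable (calderonIntegrand Ψ ω) (dilRotMeasure ν) ∧
    ∫ p, calderonIntegrand Ψ ω p ∂dilRotMeasure ν = C

section Symbol

variable {F Ψ : E n → Cl n}

lemma measurable_waveletSymbol (hF : Measurable F) (hΨ : Measurable Ψ) :
    Measurable (waveletSymbol F Ψ) := by
  have hdil : Measurable fun q : (ℝ × SO n) × E n => q.1.1 ^ ((n : ℝ) / 2) := by fun_prop
  exact (hF.comp measurable_snd).mul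
    (continuous_rev.measurable.comp (hdil.smul (hΨ.comp measurable_smul_rot_inv)))

lemma integrable_waveletSymbol (hF : MemLp F 2) (hΨ : MemLp Ψ 2) {p : ℝ × SO n} (hp : 0 < p.1) :
    Integrable fun ω => waveletSymbol F Ψ (p, ω) := by
  have hdil : MemLp (fun ω => Ψ (p.1 • rot p.2⁻¹ ω)) 2 := by
    simpa only [simil_zero] using memLp_comp_simil hp.ne' p.2 0 hΨ
  exact integrable_mul hF (memLp_rev (hdil.const_smul (p.1 ^ ((n : ℝ) / 2))))

lemma norm_waveletSymbol_sq {p : ℝ × SO n} (hp : 0 < p.1) (ω : E n) :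
    ‖waveletSymbol F Ψ (p, ω)‖ ^ 2 = inner ℝ (F ω) (F ω * calderonIntegrand Ψ ω p) := by
  have hpow : p.1 ^ n = p.1 ^ ((n : ℝ) / 2) * p.1 ^ ((n : ℝ) / 2) := by
    rw [← Real.rpow_add hp, add_halves, Real.rpow_natCast]
  rw [← real_inner_self_eq_norm_sq, waveletSymbol, inner_mul_right_eq, rev_rev, rev_smul,
    calderonIntegrand, hpow]
  simp only [mul_smul_comm, smul_mul_assoc, smul_smul, mul_assoc]

lemma cftI_waveletSymbol (hn : n % 4 = 2 ∨ n % 4 = 3) {f ψ : E n → Cl n} (hf : IsL2CFT f F)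
    (hψ : IsL2CFT ψ Ψ) {ε : ℤˣ} (hΨ : ∀ ω, PseudoCommute ε (Ψ ω)) {p : ℝ × SO n} (hp : 0 < p.1)
    (b : E n) :
    cftI (fun ω => waveletSymbol F Ψ (p, ω)) (-ε • b) =
      (2 * Real.pi) ^ n • waveletTransform ψ f (p, b) := by
  refine Eq.trans (integral_congr_ae (Eventually.of_forall fun ω => ?_))
    (smul_waveletTransform_eq p.2 b hn hp hf hψ).symm
  have hswap := ((hΨ (p.1 • rot p.2⁻¹ ω)).rev hn).expI_mul (inner ℝ ω b)
  have hsign : -inner ℝ (-ε • b) ω = ε • inner ℝ ω b := by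
    rw [real_inner_comm]
    rcases Int.units_eq_one_or ε with rfl | rfl <;> simp
  simp only [waveletSymbol, rev_smul, mul_smul_comm, smul_mul_assoc, mul_assoc, hswap, hsign]

lemma measurePreserving_units_smul (ε : ℤˣ) : MeasurePreserving (fun x : E n => ε • x) := by
  rcases Int.units_eq_one_or ε with rfl | rfl
  · simpa only [one_smul] using! MeasurePreserving.id (volume : Measure (E n))
  · simpa only [Units.neg_smul, one_smul] using
      Measure.measurePreserving_neg (volume : Measure (E n))

lemma lintegral_partialCftI_waveletSymbol (hn : n % 4 = 2 ∨ n % 4 = 3) (ν : Measure (SO n))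
    [SFinite ν] {f ψ : E n → Cl n} (hf : IsL2CFT f F) (hψ : IsL2CFT ψ Ψ)
    (hFm : Measurable F) (hΨm : Measurable Ψ) {ε : ℤˣ} (hΨ : ∀ ω, PseudoCommute ε (Ψ ω)) :
    ∫⁻ q, ‖q.2‖ₑ ^ 2 * ‖partialCftI (waveletSymbol F Ψ) q‖ₑ ^ 2
        ∂(dilRotMeasure ν).prod volume =
      ENNReal.ofReal ((2 * Real.pi) ^ n) ^ 2 *
        normSqL2 (simMeasure ν) (fun g => vec g.2 * waveletTransform ψ f g) := by
  have hreflect : MeasurePreserving (fun q : (ℝ × SO n) × E n => (q.1, -ε • q.2))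
      ((dilRotMeasure ν).prod volume) ((dilRotMeasure ν).prod volume) :=
    (MeasurePreserving.id (dilRotMeasure ν)).prod (measurePreserving_units_smul (-ε))
  have hFourier := measurable_partialCftI (measurable_waveletSymbol hFm hΨm)
  have hm : Measurable fun q : (ℝ × SO n) × E n =>
      ‖q.2‖ₑ ^ 2 * ‖partialCftI (waveletSymbol F Ψ) q‖ₑ ^ 2 := by fun_prop
  rw [← hreflect.lintegral_comp hm, normSqL2_eq, simMeasure,
    ← lintegral_const_mul' _ _ (ENNReal.pow_ne_top ENNReal.ofReal_ne_top)]
  have hpos : ∀ᵐ q ∂(dilRotMeasure ν).prod (volume : Measure (E n)), 0 < q.1.1 :=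
    Measure.quasiMeasurePreserving_fst.ae (ae_dilRotMeasure_pos ν)
  refine lintegral_congr_ae (hpos.mono fun q hq => ?_)
  have hnorm : ‖-ε • q.2‖ₑ = ‖q.2‖ₑ := by
    rcases Int.units_eq_one_or ε with rfl | rfl <;> simp
  simp only [partialCftI]
  rw [cftI_waveletSymbol hn hf hψ hΨ hq, hnorm, enorm_smul, ← ofReal_norm (vec q.2 * _),
    norm_vec_mul, ENNReal.ofReal_mul (norm_nonneg _), ofReal_norm, ofReal_norm,
    Real.enorm_of_nonneg (by positivity)]
  ring

end Symbol

/-! ### The admissibility constant -/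

lemma calderonCondition_of_clIntegral {ν : Measure (SO n)} {ψ : E n → Cl n} {C : Cl n}
    (h : ∀ᵐ ω : E n, ClIntegrable (admIntegrand ψ ω) (dilRotMeasure ν) ∧
      clIntegral (dilRotMeasure ν) (admIntegrand ψ ω) = C) :
    CalderonCondition ν (cft ψ) C :=
  h.mono fun _ hω =>
    have hi := clIntegrable_iff.1 hω.1
    ⟨hi, (clIntegral_eq hi).symm.trans hω.2⟩

namespace CalderonCondition

variable {ν : Measure (SO n)} {Ψ : E n → Cl n} {C : Cl n}

lemma congr [SFinite ν] {Ψ' : E n → Cl n} (h : CalderonCondition ν Ψ C)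
    (hΨ : Ψ =ᵐ[volume] Ψ') : CalderonCondition ν Ψ' C := by
  filter_upwards [h, ae_ae_smul_rot_inv ν hΨ] with ω hω hae
  have heq : calderonIntegrand Ψ ω =ᵐ[dilRotMeasure ν] calderonIntegrand Ψ' ω :=
    hae.mono fun p hp => by simp only [calderonIntegrand, hp]
  exact ⟨hω.1.congr heq, (integral_congr_ae heq).symm.trans hω.2⟩

lemma commute_pseudo (hn : n % 4 = 2 ∨ n % 4 = 3) (h : CalderonCondition ν Ψ C) {ε : ℤˣ}
    (hΨ : ∀ ω, PseudoCommute ε (Ψ ω)) : Commute C (pseudo n) := by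
  obtain ⟨ω, hi, rfl⟩ := h.exists
  change mulCLM.flip (pseudo n) _ = mulCLM (pseudo n) _
  rw [← ContinuousLinearMap.integral_comp_comm _ hi, ← ContinuousLinearMap.integral_comp_comm _ hi]
  refine integral_congr_ae (Eventually.of_forall fun p => ?_)
  exact ((hΨ _).commute_rev_mul_self hn).smul_left (p.1 ^ n)

lemma ae_nonneg_and_lintegral_eq (h : CalderonCondition ν Ψ C) (F : E n → Cl n) :
    ∀ᵐ ω, 0 ≤ inner ℝ (F ω) (F ω * C) ∧
      ∫⁻ p, ‖waveletSymbol F Ψ (p, ω)‖ₑ ^ 2 ∂dilRotMeasure ν =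
        ENNReal.ofReal (inner ℝ (F ω) (F ω * C)) := by
  filter_upwards [h] with ω ⟨hi, hC⟩
  let L : Cl n →L[ℝ] ℝ := (innerSL ℝ (F ω)).comp (mulCLM (F ω))
  have hL : ∀ᵐ p ∂dilRotMeasure ν,
      ‖waveletSymbol F Ψ (p, ω)‖ ^ 2 = L (calderonIntegrand Ψ ω p) :=
    (ae_dilRotMeasure_pos ν).mono fun p hp => norm_waveletSymbol_sq hp ω
  have hnonneg : 0 ≤ᵐ[dilRotMeasure ν] fun p => L (calderonIntegrand Ψ ω p) :=
    hL.mono fun p hp => (sq_nonneg _).trans_eq hp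
  have hLC : ∫ p, L (calderonIntegrand Ψ ω p) ∂dilRotMeasure ν = inner ℝ (F ω) (F ω * C) := by
    rw [L.integral_comp_comm hi, hC]; rfl
  rw [← hLC, ofReal_integral_eq_lintegral_ofReal (L.integrable_comp hi) hnonneg]
  refine ⟨integral_nonneg_of_ae hnonneg, lintegral_congr_ae (hL.mono fun p hp => ?_)⟩
  simp only [← ofReal_norm, ← ENNReal.ofReal_pow (norm_nonneg _), hp]

end CalderonCondition

section WeightedNorm

variable {X : Type*} [MeasurableSpace X] {μ : Measure X} {G : X → Cl n}

lemma scalarProd_innerCl_rev (hG : MemLp G 2 μ) (C : Cl n) :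
    scalarProd C (innerCl μ (fun x => rev (G x)) (fun x => rev (G x))) =
      ∫ x, inner ℝ (G x) (G x * C) ∂μ := by
  have hi := integrable_mul (memLp_rev hG) (memLp_rev (memLp_rev hG))
  rw [innerCl_eq (memLp_rev hG) (memLp_rev hG)]
  change scCLM (mulCLM C _) = _
  rw [← (mulCLM C).integral_comp_comm hi,
    ← scCLM.integral_comp_comm ((mulCLM C).integrable_comp hi)]
  refine integral_congr_ae (Eventually.of_forall fun x => ?_)
  change Sc (C * (rev (G x) * rev (rev (G x)))) = inner ℝ (G x) (G x * C)
  rw [rev_rev, real_inner_comm, inner_eq, ← mul_assoc, Sc_mul_comm, mul_assoc]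

lemma integrable_inner_mul (hG : MemLp G 2 μ) (C : Cl n) :
    Integrable (fun x => inner ℝ (G x) (G x * C)) μ :=
  scCLM.integrable_comp (integrable_mul hG (memLp_rev ((mulCLM.flip C).comp_memLp' hG)))

lemma starSelf_congr {G' : X → Cl n} (h : G =ᵐ[μ] G') (C : Cl n) :
    starSelf μ C G = starSelf μ C G' := by
  have hL2 : IsL2 G μ ↔ IsL2 G' μ := by rw [isL2_iff, isL2_iff, memLp_congr_ae h]
  by_cases hG : IsL2 G μ
  · have hG' := hL2.1 hG
    rw [starSelf, starSelf, if_pos hG, if_pos hG', innerCl_eq (isL2_iff.1 hG) (isL2_iff.1 hG),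
      innerCl_eq (isL2_iff.1 hG') (isL2_iff.1 hG')]
    congr 2
    exact integral_congr_ae (h.mono fun x hx => by simp only [hx])
  · rw [starSelf, starSelf, if_neg hG, if_neg (mt hL2.2 hG)]

lemma lintegral_enorm_sq_mul_le_starSelf {F : E n → Cl n} {C : Cl n}
    (hF : ∀ᵐ ω, 0 ≤ inner ℝ (F ω) (F ω * C)) :
    ∫⁻ ω, ‖ω‖ₑ ^ 2 * ENNReal.ofReal (inner ℝ (F ω) (F ω * C)) ≤
      starSelf volume C (fun ω => rev (vec ω * F ω)) := by
  unfold starSelf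
  split_ifs with h
  · have hG : MemLp (fun ω => vec ω * F ω) 2 := by
      simpa only [rev_rev] using memLp_rev (isL2_iff.1 h)
    have hvec (ω : E n) : inner ℝ (vec ω * F ω) (vec ω * F ω * C) =
        ‖ω‖ ^ 2 * inner ℝ (F ω) (F ω * C) := by
      rw [inner_mul_left_eq, rev_vec, mul_assoc, ← mul_assoc, vec_mul_self, smul_mul_assoc,
        one_mul, real_inner_smul_right]
    have hi := integrable_inner_mul hG C
    simp only [hvec] at hi
    rw [scalarProd_innerCl_rev hG]
    simp only [hvec]
    rw [ofReal_integral_eq_lintegral_ofReal hi (hF.mono fun ω hω => by positivity)]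
    refine le_of_eq (lintegral_congr fun ω => ?_)
    rw [ENNReal.ofReal_mul (by positivity), ENNReal.ofReal_pow (norm_nonneg _), ofReal_norm]
  · exact le_top

lemma IsL2CFT.integral_inner_mul (hn : n % 4 = 2 ∨ n % 4 = 3) {f F : E n → Cl n}
    (hf : IsL2CFT f F) {C : Cl n} (hC : Commute C (pseudo n)) :
    ∫ ω, inner ℝ (F ω) (F ω * C) = (2 * Real.pi) ^ n *
      scalarProd C (innerCl volume (fun x => rev (f x)) (fun x => rev (f x))) := by
  rw [scalarProd_innerCl_rev hf.memLp_left]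
  refine hf.integral_inner hn (hf.clm_comp hn (mulCLM.flip C) fun M t => ?_)
  have hexp : Commute C (expI t) :=
    ((Commute.one_right C).smul_right _).add_right (hC.smul_right _)
  simp only [ContinuousLinearMap.flip_apply, mulCLM_apply, mul_assoc, hexp.eq]

end WeightedNorm

/-! ### The uncertainty principle -/

section Uncertainty

variable {ν : Measure (SO n)} {f F Ψ : E n → Cl n} {C : Cl n}

lemma CalderonCondition.scalarProd_nonneg (hn : n % 4 = 2 ∨ n % 4 = 3) (hf : IsL2CFT f F)
    (hΨ : CalderonCondition ν Ψ C) (hC : Commute C (pseudo n)) :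
    0 ≤ scalarProd C (innerCl volume (fun x => rev (f x)) (fun x => rev (f x))) := by
  have hint : 0 ≤ ∫ ω, inner ℝ (F ω) (F ω * C) :=
    integral_nonneg_of_ae ((hΨ.ae_nonneg_and_lintegral_eq F).mono fun ω h => h.1)
  rw [hf.integral_inner_mul hn hC] at hint
  exact nonneg_of_mul_nonneg_right hint (by positivity)

variable [SFinite ν]

lemma lintegral_waveletSymbol_sq (hn : n % 4 = 2 ∨ n % 4 = 3) (hf : IsL2CFT f F)
    (hFm : Measurable F) (hΨm : Measurable Ψ) (hΨ : CalderonCondition ν Ψ C)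
    (hC : Commute C (pseudo n)) :
    ∫⁻ q, ‖waveletSymbol F Ψ q‖ₑ ^ 2 ∂(dilRotMeasure ν).prod volume =
      ENNReal.ofReal ((2 * Real.pi) ^ n *
        scalarProd C (innerCl volume (fun x => rev (f x)) (fun x => rev (f x)))) := by
  have hCalderon := hΨ.ae_nonneg_and_lintegral_eq F
  rw [lintegral_prod_symm' _ ((measurable_waveletSymbol hFm hΨm).enorm.pow_const 2),
    lintegral_congr_ae (hCalderon.mono fun ω h => h.2), ← hf.integral_inner_mul hn hC,
    ofReal_integral_eq_lintegral_ofReal (integrable_inner_mul hf.memLp_right C)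
      (hCalderon.mono fun ω h => h.1)]

lemma lintegral_enorm_sq_mul_waveletSymbol_sq_le (hFm : Measurable F) (hΨm : Measurable Ψ)
    (hΨ : CalderonCondition ν Ψ C) :
    ∫⁻ q, ‖q.2‖ₑ ^ 2 * ‖waveletSymbol F Ψ q‖ₑ ^ 2 ∂(dilRotMeasure ν).prod volume ≤
      starSelf volume C (fun ω => rev (vec ω * F ω)) := by
  have hCalderon := hΨ.ae_nonneg_and_lintegral_eq F
  have hsymbol := measurable_waveletSymbol hFm hΨm
  have hm : Measurable fun q : (ℝ × SO n) × E n =>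
      ‖q.2‖ₑ ^ 2 * ‖waveletSymbol F Ψ q‖ₑ ^ 2 := by fun_prop
  rw [lintegral_prod_symm' _ hm]
  refine Eq.trans_le (lintegral_congr_ae ?_)
    (lintegral_enorm_sq_mul_le_starSelf (hCalderon.mono fun ω h => h.1))
  filter_upwards [hCalderon] with ω hω
  rw [lintegral_const_mul' _ _ (by simp), hω.2]

lemma ofReal_le_of_scaled_le {c κ S : ℝ} (hc : 0 ≤ c) (hκ : 0 < κ) (hS : 0 ≤ S) {N Y : ℝ≥0∞}
    (h : ENNReal.ofReal c * (ENNReal.ofReal κ * ENNReal.ofReal (κ * S) ^ 2) ≤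
      4 * (ENNReal.ofReal κ ^ 2 * N) * Y) :
    ENNReal.ofReal (c * κ / 4 * S ^ 2) ≤ N * Y := by
  have hκ4 : ENNReal.ofReal κ ^ 2 * 4 = ENNReal.ofReal (κ ^ 2 * 4) := by
    rw [ENNReal.ofReal_mul (by positivity), ENNReal.ofReal_pow hκ.le]; simp
  rw [← ENNReal.mul_le_mul_iff_right (ENNReal.ofReal_pos.2 (by positivity : 0 < κ ^ 2 * 4)).ne'
    ENNReal.ofReal_ne_top]
  calc ENNReal.ofReal (κ ^ 2 * 4) * ENNReal.ofReal (c * κ / 4 * S ^ 2)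
      = ENNReal.ofReal c * (ENNReal.ofReal κ * ENNReal.ofReal (κ * S) ^ 2) := by
        rw [← ENNReal.ofReal_pow (by positivity), ← ENNReal.ofReal_mul hκ.le,
          ← ENNReal.ofReal_mul hc, ← ENNReal.ofReal_mul (by positivity)]
        ring_nf
    _ ≤ 4 * (ENNReal.ofReal κ ^ 2 * N) * Y := h
    _ = ENNReal.ofReal (κ ^ 2 * 4) * (N * Y) := by rw [← hκ4]; ring

theorem waveletTransform_uncertainty (hn : n % 4 = 2 ∨ n % 4 = 3) {ψ : E n → Cl n}
    (hf : IsL2CFT f F) (hψ : IsL2CFT ψ Ψ) (hFm : Measurable F) (hΨm : Measurable Ψ) {ε : ℤˣ}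
    (hε : ∀ ω, PseudoCommute ε (Ψ ω)) (hΨ : CalderonCondition ν Ψ C) :
    ENNReal.ofReal ((n : ℝ) ^ 2 * (2 * Real.pi) ^ n / 4 *
        (scalarProd C (innerCl volume (fun x => rev (f x)) (fun x => rev (f x)))) ^ 2) ≤
      normSqL2 (simMeasure ν) (fun g => vec g.2 * waveletTransform ψ f g) *
        starSelf volume C (fun ω => rev (vec ω * F ω)) := by
  have hC : Commute C (pseudo n) := hΨ.commute_pseudo hn hε
  have hZ := lintegral_waveletSymbol_sq hn hf hFm hΨm hΨ hC
  have hX := lintegral_partialCftI_waveletSymbol hn ν hf hψ hFm hΨm hε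
  have hY := lintegral_enorm_sq_mul_waveletSymbol_sq_le hFm hΨm hΨ
  have hslices : ∀ᵐ p ∂dilRotMeasure ν, Integrable fun ω => waveletSymbol F Ψ (p, ω) :=
    (ae_dilRotMeasure_pos ν).mono fun p hp =>
      integrable_waveletSymbol hf.memLp_right hψ.memLp_right hp
  have hHeisenberg := partial_uncertainty hn (measurable_waveletSymbol hFm hΨm) hslices
    (hZ ▸ ENNReal.ofReal_ne_top)
  rw [hX, hZ] at hHeisenberg
  refine ofReal_le_of_scaled_le (by positivity) (by positivity) (hΨ.scalarProd_nonneg hn hf hC) ?_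
  rw [ENNReal.ofReal_pow n.cast_nonneg, ENNReal.ofReal_natCast]
  exact hHeisenberg.trans (by gcongr)

end Uncertainty

end CliffordWavelet

end

open CliffordWavelet in
theorem mainTheorem3_general (n : ℕ) (hn : n % 4 = 2 ∨ n % 4 = 3)
    (ν : Measure (SO n)) [SFinite ν]
    (ψ : E n → Cl n) (C : Cl n) (hψ : IsL2 ψ volume)
    (hC : ∀ᵐ ω : E n, ClIntegrable (admIntegrand ψ ω) (dilRotMeasure ν) ∧
      clIntegral (dilRotMeasure ν) (admIntegrand ψ ω) = C)
    (hpar : n % 4 = 2 → HasParity ψ)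
    (f : E n → Cl n) (hf : IsL2 f volume) :
    ENNReal.ofReal ((n : ℝ) ^ 2 * (2 * Real.pi) ^ n / 4 *
        (scalarProd C (innerCl volume (fun x => rev (f x)) (fun x => rev (f x)))) ^ 2) ≤
      normSqL2 (simMeasure ν) (fun g => vec g.2 * waveletTransform ψ f g) *
        starSelf volume C (fun ω => rev (vec ω * cft f ω)) := by
  have hfF := isL2CFT_cft hn (isL2_iff.1 hf)
  have hψΨ := isL2CFT_cft hn (isL2_iff.1 hψ)
  obtain ⟨ε, hε⟩ := hψΨ.exists_pseudoCommute hn hpar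
  obtain ⟨Ψ, hΨm, hΨ, hΨε⟩ := exists_measurable_pseudoCommute hψΨ.memLp_right.1 hε
  obtain ⟨F, hFm, hF⟩ := hfF.memLp_right.1
  have hstar : starSelf volume C (fun ω => rev (vec ω * cft f ω)) =
      starSelf volume C (fun ω => rev (vec ω * F ω)) :=
    starSelf_congr (hF.mono fun ω hω => by simp only [hω]) C
  rw [hstar]
  exact waveletTransform_uncertainty hn (hfF.congr_right hF) (hψΨ.congr_right hΨ) hFm.measurable
    hΨm hΨε ((calderonCondition_of_clIntegral hC).congr hΨ)

open CliffordWavelet in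
theorem mainTheorem3 (n : ℕ) (hn : n % 4 = 2 ∨ n % 4 = 3)
    (ν : Measure (SO n)) [ν.IsHaarMeasure]
    (ψ : E n → Cl n) (C : Cl n) (hψ : IsAdmissible ν ψ C)
    (hpar : n % 4 = 2 → HasParity ψ)
    (f : E n → Cl n) (hf : IsL2 f volume) :
    ENNReal.ofReal ((n : ℝ) * (2 * Real.pi) ^ n / 4 *
        (scalarProd C (innerCl volume (fun x => rev (f x)) (fun x => rev (f x)))) ^ 2) ≤
      normSqL2 (simMeasure ν) (fun g => vec g.2 * waveletTransform ψ f g) *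
        starSelf volume C (fun ω => rev (vec ω * cft f ω)) := by
  have hle : (n : ℝ) ≤ (n : ℝ) ^ 2 := mod_cast Nat.le_self_pow two_ne_zero n
  exact (ENNReal.ofReal_le_ofReal (by gcongr)).trans
    (mainTheorem3_general n hn ν ψ C hψ.1 hψ.2.2 hpar f hf)
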